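/- **Scheduling model.** An instance consists of $n$ jobs for a single machine; job $j$ has a processing time $p_j\ge 1$, a release time $r_j\ge 0$ and a type $\tau_j$ (any number of types). The machine is available from time $0$ on and processes at most one job at a time, without preemption. A setup of constant length $s\ge 0$ is needed before the first job and whenever the machine switches to a job of a different type; no job is processed during a setup. If job $j$ is started at $t_j\ge r_j$, its flow time is $F_j=t_j+p_j-r_j$. The maximum flow time of a schedule is $\max_j F_j$, and $F^*(\mathcal I)$ denotes the infimum of the maximum flow time over all feasible schedules of instance $\mathcal I$ (the offline optimum; it may perform a setup before the release of the job it is made for). **Balance.** Fix $\alpha=13$ and start with $\lambda=\alpha$. Whenever the machine is idle and at least one released, unprocessed job is available, let $t$ be the current time and let active$(t)$ be the type the machine is configured for (none at the beginning). Balance selects an available job $j$ with smallest adjusted release time $\bar r_j(t)$, where $\bar r_j(t)=r_j$ if $\tau_j=\mathrm{active}(t)$ and $\bar r_j(t)=r_j+\lambda$ otherwise; ties are broken in favour of jobs of type active$(t)$, remaining ties arbitrarily. It then performs a setup if $\tau_j\ne\mathrm{active}(t)$ and processes $j$. When a job $j$ completes with $F_j\ge\alpha\lambda$, $\lambda$ is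 replaced by $\alpha\lambda$. Let $F(\mathcal I)$ be the maximum flow time of Balance on $\mathcal I$ (for the worst way of breaking the remaining ties). **Smoothing.** For $x\in\mathbb R^n$ let $\mathcal I_x$ be the instance $\mathcal I$ with $p_j$ replaced by $\hat p_j=(1+x_j)p_j$. For a probability distribution $f$ on $\mathbb R$, the smoothed competitiveness of Balance on $n$ jobs is $$c_{\rm smooth}(n,s,f)=\sup_{\mathcal I}\ \mathbb E\left[\frac{F(\mathcal I_X)}{F^*(\mathcal I_X)}\right],$$ where $X_1,\dots,X_n$ are independent with distribution $f$ and the supremum is over all instances with $n$ jobs. **Theorem.** For every setup time $s\ge 0$ there is a constant $C=C(s)>0$ such that for all $0<\varepsilon<1$ and all $n\ge 2$: 1. (uniform smoothing) if $f=\mathcal U(-\varepsilon,\varepsilon)$, whose standard deviation is $\sigma=\varepsilon/\sqrt3$, then $c_{\rm smooth}(n,s,f)\le C\,\sigma^{-2}\log^2 n$; 2. (normal smoothing) if $f=\mathcal N_{(-1,1)}(0,\sigma^2)$ is the normal distribution with mean $0$ and standard deviation $\sigma=\varepsilon/\sqrt{2.64}$, truncated to $(-1,1)$, then $c_{\rm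 smooth}(n,s,f)\le C\,\sigma^{-2}\log^2 n$. -/

import Mathlib

open scoped ENNReal

noncomputable section

namespace SetupScheduling

/-- `n` jobs for one machine: processing times `p`, release times `r` and job types `typ`.
Any number of types may occur. -/
structure Jobs (n : ℕ) where
  p : Fin n → ℝ
  r : Fin n → ℝ
  typ : Fin n → ℕ

variable {n : ℕ}

/-- The instances an adversary may choose: `p j ≥ 1` and `r j ≥ 0`. -/
def Jobs.Admissible (I : Jobs n) : Prop :=
  (∀ j, 1 ≤ I.p j) ∧ ∀ j, 0 ≤ I.r j

/-- The instance with `p j` replaced by `(1 + x j) * p j`. -/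
def Jobs.perturb (I : Jobs n) (x : Fin n → ℝ) : Jobs n :=
  { I with p := fun j => (1 + x j) * I.p j }

/-- The setup time needed between two jobs that are processed one after the other. -/
def Jobs.setup (I : Jobs n) (s : ℝ) (i j : Fin n) : ℝ :=
  if I.typ i = I.typ j then 0 else s

/-- Feasible non-preemptive (offline) schedules, given by the starting times `t`. The machine
is available from time `0` on and is set up once before the first job. Of two jobs, one is
completed before the other starts, with room for a setup between them if their types differ
(asking this of all pairs is the same as asking it of pairs that are processed consecutively). A
setup may be done before the job it is made for has been released. -/
structure Jobs.Feasible (I : Jobs n) (s : ℝ) (t : Fin n → ℝ) : Prop where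
  release : ∀ j, I.r j ≤ t j
  initial : ∀ j, s ≤ t j
  separated : ∀ i j, i ≠ j →
    t i + I.p i + I.setup s i j ≤ t j ∨ t j + I.p j + I.setup s j i ≤ t i

/-- The maximum flow time of a schedule with starting times `t`. -/
def Jobs.maxFlow (I : Jobs n) (t : Fin n → ℝ) : ℝ :=
  ⨆ j, (t j + I.p j - I.r j)

/-- The optimal (offline, clairvoyant) maximum flow time. -/
def Jobs.optFlow (I : Jobs n) (s : ℝ) : ℝ≥0∞ :=
  ⨅ (t : Fin n → ℝ) (_ : I.Feasible s t), ENNReal.ofReal (I.maxFlow t)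

/-! ### The algorithm Balance -/

/-- The constant by which the balance parameter starts and grows. -/
def α : ℝ := 13

/-- The state of a run of Balance: the time at which the machine got idle, the type it
is configured for (`none` before the first setup), the balance parameter, the jobs processed so
far and their starting times (with value `0` for the other jobs). -/
structure State (n : ℕ) where
  time : ℝ
  active : Option ℕ
  lam : ℝ
  done : Finset (Fin n)
  start : Fin n → ℝ

/-- The state before the first job. -/
def State.init (n : ℕ) : State n :=
  { time := 0, active := none, lam := α, done := ∅, start := fun _ => 0 }

/-- The adjusted release time of job `j`. -/
def Jobs.adjRelease (I : Jobs n) (S : State n) (j : Fin n) : ℝ :=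
  if S.active = some (I.typ j) then I.r j else I.r j + S.lam

/-- The jobs available at time `d`: released and not processed yet. -/
def Jobs.Available (I : Jobs n) (S : State n) (d : ℝ) (j : Fin n) : Prop :=
  j ∉ S.done ∧ I.r j ≤ d

/-- `d` is the next time at which Balance decides on a job: the first time from
`S.time` on at which some job is available. -/
def Jobs.IsDecisionTime (I : Jobs n) (S : State n) (d : ℝ) : Prop :=
  IsLeast {d | S.time ≤ d ∧ ∃ j, I.Available S d j} d

/-- At time `d` Balance may select job `j`: it is available and has the smallest adjusted release
time, where ties are broken in favour of the active type. The remaining ties are broken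
arbitrarily. -/
def Jobs.MaySelect (I : Jobs n) (S : State n) (d : ℝ) (j : Fin n) : Prop :=
  I.Available S d j ∧ ∀ j', I.Available S d j' →
    I.adjRelease S j < I.adjRelease S j' ∨
      I.adjRelease S j = I.adjRelease S j' ∧
        (S.active = some (I.typ j') → S.active = some (I.typ j))

/-- The starting time of job `j` if it is selected at time `d`: a setup comes first if
the machine is not configured for its type. -/
def Jobs.startTime (I : Jobs n) (s : ℝ) (S : State n) (d : ℝ) (j : Fin n) : ℝ :=
  if S.active = some (I.typ j) then d else d + s

/-- The state after the completion of a job `j` selected at time `d`. -/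
def Jobs.process (I : Jobs n) (s : ℝ) (S : State n) (d : ℝ) (j : Fin n) : State n :=
  { time := I.startTime s S d j + I.p j
    active := some (I.typ j)
    lam := if α * S.lam ≤ I.startTime s S d j + I.p j - I.r j then α * S.lam else S.lam
    done := insert j S.done
    start := Function.update S.start j (I.startTime s S d j) }

/-- The states that Balance can reach on the instance `I`. -/
inductive Jobs.Reachable (I : Jobs n) (s : ℝ) : State n → Prop
  | init : Reachable I s (State.init n)
  | step (S : State n) (d : ℝ) (j : Fin n) : Reachable I s S → I.IsDecisionTime S d →
      I.MaySelect S d j → Reachable I s (I.process s S d j)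

/-- `t` are the starting times of a complete schedule that Balance can produce. -/
def Jobs.IsBalanceSchedule (I : Jobs n) (s : ℝ) (t : Fin n → ℝ) : Prop :=
  ∃ S : State n, I.Reachable s S ∧ S.done = Finset.univ ∧ S.start = t

/-- The maximum flow time of Balance, for the worst way of breaking the remaining ties. -/
def Jobs.balanceFlow (I : Jobs n) (s : ℝ) : ℝ≥0∞ :=
  ⨆ (t : Fin n → ℝ) (_ : I.IsBalanceSchedule s t), ENNReal.ofReal (I.maxFlow t)

/-! ### Smoothed competitiveness -/

/-- The smoothed competitiveness of Balance on `n` jobs with setup time `s`, when the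
relative perturbations of the processing times are independent with law `μ`. -/
def smoothedCompetitiveness (n : ℕ) (s : ℝ) (μ : MeasureTheory.Measure ℝ) : ℝ≥0∞ :=
  ⨆ (I : Jobs n) (_ : I.Admissible),
    ∫⁻ x, (I.perturb x).balanceFlow s / (I.perturb x).optFlow s
      ∂(MeasureTheory.Measure.pi fun _ : Fin n => μ)

/-- The uniform distribution on `[-ε, ε]`. -/
def uniformSmoothing (ε : ℝ) : MeasureTheory.Measure ℝ :=
  ProbabilityTheory.cond MeasureTheory.volume (Set.Icc (-ε) ε)

/-- The normal distribution with mean `0` and standard deviation `σ`, truncated to `(-1, 1)`. -/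
def normalSmoothing (σ : ℝ) : MeasureTheory.Measure ℝ :=
  ProbabilityTheory.cond (ProbabilityTheory.gaussianReal 0 (σ ^ 2).toNNReal) (Set.Ioo (-1) 1)

end SetupScheduling

end

open scoped ENNReal

noncomputable section

namespace SetupScheduling

variable {n : ℕ}

/-! Let `Φ` bound the flow times of some offline schedule and let `Q` be at least `s + p j` for all
`j`. Comparing Balance with that schedule bounds its flow times by `16 * lam + 2 * Q + Φ + s ^ 2`
(`Reachable.flow_le`), so only the growth of `lam` has to be controlled.

If Balance enlarges a `lam` that is already large against `Φ` and `s`, it has been busy for long.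
Two setups for the same type in the busy period belong to jobs released at least `lam` apart, so
some release interval is overloaded: its work plus one setup per member of a `lam`-spread set
exceeds its length by `7 * lam` (`lam_le_or_isOverloaded`). The offline schedule also pays nearly
all these setups, because far apart jobs of one type cannot share a batch unless time passes between
them (`work_add_setups_le'`). Cutting the interval into windows of length `L`, every window has
nonnegative slack, yet the average slack is small (`sum_slack_le`).

Smoothing makes this unlikely. Releases and types are not perturbed, so a window's slack is a
constant minus `∑ p j * x j`. By fourth moments it is negative or at least `δ * lam` with a constant
probability `q`. Windows are independent, and `40 / (q * δ)` of them are needed, so an exponential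
moment bound gives `exp (-(20 / δ))`. Only polynomially many events matter
(`lam_le_of_isOverloaded`), hence `δ` of order `σ ^ 2 / log n` suffices, and outside the bad event
the ratio is of order `1 / δ` up to additive constants.

Perturbed processing times may be close to `0`, so additive constants divided by the optimum are not
bounded. Two independent jobs make them integrable: `1 / max a b ≤ 1 / (√a * √b)`. -/

/-- Jobs of the same type in `O` have release times at distance at least `lam`. -/
def Jobs.Spread (I : Jobs n) (lam : ℝ) (O : Finset (Fin n)) : Prop :=
  ∀ i ∈ O, ∀ j ∈ O, i ≠ j → I.typ i = I.typ j → lam ≤ |I.r i - I.r j|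

theorem Jobs.Spread.mono {I : Jobs n} {lam : ℝ} {O O' : Finset (Fin n)} (h : I.Spread lam O)
    (hO : O' ⊆ O) : I.Spread lam O' :=
  fun i hi j hj => h i (hO hi) j (hO hj)

/-! ### Lower bounds for offline schedules: work and unavoidable setups. -/

section Offline

variable {I : Jobs n} {s Φ lam : ℝ} {t : Fin n → ℝ}

theorem Jobs.Feasible.add_le (hs : 0 ≤ s) (hp : ∀ j, 0 < I.p j) (ht : I.Feasible s t)
    {i j : Fin n} (hij : i ≠ j) (hle : t i ≤ t j) :
    t i + I.p i + (if I.typ i = I.typ j then 0 else s) ≤ t j := by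
  rcases ht.separated i j hij with h | h
  · exact h
  · have h0 : 0 ≤ I.setup s j i := by
      unfold Jobs.setup; split_ifs <;> simp [hs]
    linarith [hp j]

/-- A job starts less than `Φ` after its release, so release times `lam` apart force starts `lam -
Φ` apart, in the same order. -/
theorem Jobs.Feasible.gap (hp : ∀ j, 0 < I.p j) (ht : I.Feasible s t)
    (hΦ : ∀ j, t j + I.p j - I.r j ≤ Φ) (hlam : Φ ≤ lam) {O : Finset (Fin n)}
    (hO : I.Spread lam O) {i j : Fin n} (hi : i ∈ O) (hj : j ∈ O) (hij : i ≠ j)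
    (htyp : I.typ i = I.typ j) (hle : t i ≤ t j) : t i + (lam - Φ) ≤ t j := by
  have h1 := hO i hi j hj hij htyp
  have h2 := hΦ i
  have h3 := hΦ j
  have h4 := ht.release i
  have h5 := ht.release j
  have h6 := hp i
  have h7 := hp j
  rcases le_abs.1 h1 with h | h <;> linarith

/-- Jobs are added in the order of their starts; `l` is the last one and `o` the last member of `O`.
The number `e` counts members of `O` to which no setup is charged: the first one, and those of the
same type as the preceding member. The `if` is a credit for a setup made since `o` that the next
member may claim. -/
theorem Jobs.Feasible.work_invariant (hs : 0 ≤ s) (hp : ∀ j, 0 < I.p j) (ht : I.Feasible s t)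
    (hΦ : ∀ j, t j + I.p j - I.r j ≤ Φ) (hlam : Φ ≤ lam) {O : Finset (Fin n)}
    (hO : I.Spread lam O) {u : ℝ} (J : Finset (Fin n)) :
    (∀ j ∈ J, u ≤ I.r j) → J = ∅ ∨ ∃ l ∈ J, (∀ j ∈ J, t j ≤ t l) ∧
      ((J ∩ O = ∅ ∧ ∑ j ∈ J, I.p j ≤ t l + I.p l - u) ∨
        ∃ o ∈ J ∩ O, (∀ j ∈ J ∩ O, t j ≤ t o) ∧ ∃ e : ℕ, e ≤ (J ∩ O).card ∧
          ((e : ℝ) - 1) * (lam - Φ) ≤ t o - u ∧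
          ∑ j ∈ J, I.p j + s * (J ∩ O).card + (if I.typ l = I.typ o then 0 else s) ≤
            t l + I.p l - u + s * e) := by
  classical
  induction J using Finset.induction_on_max_value t with
  | empty => intro _; exact Or.inl rfl
  | insert y J hy hmax ih =>
    intro hu
    right
    have huy : u ≤ t y := (hu y (Finset.mem_insert_self _ _)).trans (ht.release y)
    refine ⟨y, Finset.mem_insert_self _ _, ?_, ?_⟩
    · intro j hj
      rcases Finset.mem_insert.1 hj with rfl | hj
      · exact le_rfl
      · exact hmax j hj
    have hcard : y ∈ O → (insert y J ∩ O).card = (J ∩ O).card + 1 := by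
      intro hyO
      rw [Finset.insert_inter_of_mem hyO, Finset.card_insert_of_notMem]
      simp [hy]
    have hmaxO : ∀ j ∈ insert y J ∩ O, t j ≤ t y := by
      intro j hj
      rcases Finset.mem_insert.1 (Finset.mem_inter.1 hj).1 with rfl | hj
      · exact le_rfl
      · exact hmax j hj
    rw [Finset.sum_insert hy]
    rcases ih (fun j hj => hu j (Finset.mem_insert_of_mem hj)) with rfl | ⟨l, hl, hlmax, h⟩
    · by_cases hyO : y ∈ O
      · right
        refine ⟨y, by simp [hyO], hmaxO, 1, ?_, ?_, ?_⟩
        · rw [hcard hyO]; simp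
        · simp; linarith
        · rw [hcard hyO]; simp; linarith
      · left
        refine ⟨by rw [Finset.insert_inter_of_notMem hyO]; simp, by simp; linarith⟩
    have hly : l ≠ y := fun h => hy (h ▸ hl)
    have hstep := ht.add_le hs hp hly (hmax l hl)
    have hstep' : t l + I.p l ≤ t y := by
      split_ifs at hstep <;> linarith
    rcases h with ⟨hemp, hsum⟩ | ⟨o, ho, homax, e, he, hgap, hsum⟩
    · by_cases hyO : y ∈ O
      · right
        refine ⟨y, by simp [hyO], hmaxO, 1, ?_, ?_, ?_⟩
        · rw [hcard hyO]; simp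
        · simp; linarith
        · rw [hcard hyO, hemp]; simp; linarith
      · left
        refine ⟨by rw [Finset.insert_inter_of_notMem hyO, hemp], by linarith⟩
    · right
      have hoJ := (Finset.mem_inter.1 ho).1
      have hoO := (Finset.mem_inter.1 ho).2
      by_cases hyO : y ∈ O
      -- For equal types `e` grows, and the gap between the two starts pays for it. Otherwise a
      -- setup happened after `o`, either just before `y` or already held as credit.
      · by_cases htyp : I.typ o = I.typ y
        · refine ⟨y, by simp [hyO], hmaxO, e + 1, ?_, ?_, ?_⟩
          · rw [hcard hyO]; omega
          · have := ht.gap hp hΦ hlam hO hoO hyO (fun h => hy (h ▸ hoJ)) htyp (hmax o hoJ)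
            push_cast; linarith
          · rw [hcard hyO]
            have : (0 : ℝ) ≤ if I.typ l = I.typ o then 0 else s := by split_ifs <;> simp [hs]
            push_cast
            simp only [if_true]
            linarith
        · refine ⟨y, by simp [hyO], hmaxO, e, ?_, ?_, ?_⟩
          · rw [hcard hyO]; omega
          · have := hmax o hoJ
            linarith
          · rw [hcard hyO]
            push_cast
            simp only [if_true]
            by_cases hlo : I.typ l = I.typ o
            · rw [if_pos hlo] at hsum
              rw [if_neg (by rw [hlo]; exact htyp)] at hstep
              linarith
            · rw [if_neg hlo] at hsum
              linarith
      · have heq : insert y J ∩ O = J ∩ O := Finset.insert_inter_of_notMem hyO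
        rw [heq]
        refine ⟨o, ho, homax, e, he, hgap, ?_⟩
        by_cases hly' : I.typ l = I.typ y
        · rw [if_pos hly'] at hstep
          rw [hly'] at hsum
          linarith
        · rw [if_neg hly'] at hstep
          have h1 : (0 : ℝ) ≤ if I.typ l = I.typ o then 0 else s := by split_ifs <;> simp [hs]
          have h2 : (if I.typ y = I.typ o then 0 else s) ≤ s := by split_ifs <;> simp [hs]
          linarith

/-- An offline schedule with flow times at most `Φ` has to fit the jobs released in `[u, v]` and
almost one setup for each member of a spread set into `[u, v + Φ]`. -/
theorem Jobs.Feasible.work_add_setups_le (hs : 0 ≤ s) (hp : ∀ j, 0 < I.p j) (ht : I.Feasible s t)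
    (hΦ0 : 0 ≤ Φ) (hΦ : ∀ j, t j + I.p j - I.r j ≤ Φ) (hlam : Φ ≤ lam) {O J : Finset (Fin n)}
    (hO : I.Spread lam O) (hOJ : O ⊆ J) {u v : ℝ} (huv : u ≤ v) (hJ : ∀ j ∈ J, u ≤ I.r j)
    (hJ' : ∀ j ∈ J, I.r j ≤ v) :
    ∃ e : ℕ, e ≤ O.card ∧ ((e : ℝ) - 1) * (lam - Φ) ≤ v - u + Φ ∧
      ∑ j ∈ J, I.p j + s * O.card ≤ v - u + Φ + s * e := by
  have hJO : J ∩ O = O := Finset.inter_eq_right.2 hOJ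
  have hl0 : 0 ≤ lam - Φ := by linarith
  rcases ht.work_invariant hs hp hΦ hlam hO (u := u) J hJ with rfl | ⟨l, hl, -, h⟩
  · have : O = ∅ := Finset.subset_empty.1 hOJ
    subst this
    refine ⟨0, by simp, ?_, ?_⟩ <;> simp <;> nlinarith
  have h1 := hΦ l
  have h2 := hJ' l hl
  rw [hJO] at h
  rcases h with ⟨rfl, h⟩ | ⟨o, ho, -, e, he, hgap, hsum⟩
  · refine ⟨0, by simp, ?_, ?_⟩ <;> simp <;> nlinarith
  · refine ⟨e, he, ?_, ?_⟩
    · have h3 := hΦ o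
      have h4 := hJ' o (hOJ ho)
      have h5 := hp o
      linarith
    · have h3 : (0 : ℝ) ≤ if I.typ l = I.typ o then 0 else s := by split_ifs <;> simp [hs]
      linarith

theorem Jobs.Feasible.work_le (hs : 0 ≤ s) (hp : ∀ j, 0 < I.p j) (ht : I.Feasible s t)
    (hΦ0 : 0 ≤ Φ) (hΦ : ∀ j, t j + I.p j - I.r j ≤ Φ) {J : Finset (Fin n)} {u v : ℝ}
    (huv : u ≤ v) (hJ : ∀ j ∈ J, u ≤ I.r j) (hJ' : ∀ j ∈ J, I.r j ≤ v) :
    ∑ j ∈ J, I.p j ≤ v - u + Φ := by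
  obtain ⟨e, he, -, h⟩ := ht.work_add_setups_le (O := ∅) hs hp hΦ0 hΦ le_rfl
    (fun i hi => absurd hi (Finset.notMem_empty i)) (Finset.empty_subset J) huv hJ hJ'
  simp only [Finset.card_empty, Nat.le_zero] at he
  subst he
  simpa using h

/-- With `Φ ≤ lam / 2` the gaps are at least `lam / 2`, so few setups can be saved. -/
theorem Jobs.Feasible.work_add_setups_le' (hs : 0 ≤ s) (hp : ∀ j, 0 < I.p j)
    (ht : I.Feasible s t) (hΦ0 : 0 ≤ Φ) (hΦ : ∀ j, t j + I.p j - I.r j ≤ Φ) (hlam0 : 0 < lam)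
    (hlam : Φ ≤ lam / 2) {O J : Finset (Fin n)} (hO : I.Spread lam O) (hOJ : O ⊆ J) {u v : ℝ}
    (huv : u ≤ v) (hJ : ∀ j ∈ J, u ≤ I.r j) (hJ' : ∀ j ∈ J, I.r j ≤ v) :
    ∑ j ∈ J, I.p j + s * O.card ≤ v - u + Φ + s * (2 + 2 * (v - u) / lam) := by
  obtain ⟨e, -, he, h⟩ := ht.work_add_setups_le hs hp hΦ0 hΦ (by linarith) hO hOJ huv hJ hJ'
  have : (e : ℝ) ≤ 2 + 2 * (v - u) / lam := by
    by_contra! hlt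
    have h1 : 1 + 2 * (v - u) / lam < (e : ℝ) - 1 := by linarith
    have h2 : 2 * (v - u) / lam * lam = 2 * (v - u) := by field_simp
    have h3 : 0 ≤ 2 * (v - u) / lam := by
      apply div_nonneg <;> linarith
    nlinarith
  nlinarith

end Offline

/-! ### Flow times of Balance in terms of its current parameter. -/

section Balance

variable {I : Jobs n} {s Φ Q : ℝ} {S : State n} {d : ℝ} {j : Fin n}

theorem Jobs.IsDecisionTime.time_le (hd : I.IsDecisionTime S d) : S.time ≤ d :=
  hd.1.1

theorem Jobs.IsDecisionTime.eq_or_le_release (hd : I.IsDecisionTime S d) :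
    d = S.time ∨ ∀ y ∉ S.done, d ≤ I.r y := by
  rcases hd.time_le.eq_or_lt with h | h
  · exact Or.inl h.symm
  right
  intro y hy
  by_contra! hlt
  have := hd.2 (show max S.time (I.r y) ∈ _ from ⟨le_max_left _ _, y, hy, le_max_right _ _⟩)
  exact absurd (this.trans_lt (max_lt h hlt)) (lt_irrefl _)

theorem Jobs.le_adjRelease (h0 : 0 ≤ S.lam) (y : Fin n) : I.r y ≤ I.adjRelease S y := by
  unfold Jobs.adjRelease; split_ifs <;> linarith

theorem Jobs.adjRelease_le (h0 : 0 ≤ S.lam) (y : Fin n) :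
    I.adjRelease S y ≤ I.r y + S.lam := by
  unfold Jobs.adjRelease; split_ifs <;> linarith

theorem Jobs.MaySelect.adjRelease_le (hj : I.MaySelect S d j) {y : Fin n} (hy : y ∉ S.done)
    (hyd : I.r y ≤ d) : I.adjRelease S j ≤ I.adjRelease S y := by
  rcases hj.2 y ⟨hy, hyd⟩ with h | h
  · exact h.le
  · exact h.1.le

theorem Jobs.MaySelect.release_le (hj : I.MaySelect S d j) (h0 : 0 ≤ S.lam) {y : Fin n}
    (hy : y ∉ S.done) : I.r j ≤ I.r y + S.lam := by
  rcases le_or_gt (I.r y) d with h | h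
  · exact (I.le_adjRelease h0 j).trans ((hj.adjRelease_le hy h).trans (I.adjRelease_le h0 y))
  · linarith [hj.1.2]

/-- If Balance performs a setup for `j`, then `j` is the oldest job. -/
theorem Jobs.MaySelect.release_le_of_setup (hj : I.MaySelect S d j) (h0 : 0 ≤ S.lam)
    (hact : S.active ≠ some (I.typ j)) {y : Fin n} (hy : y ∉ S.done) : I.r j ≤ I.r y := by
  rcases le_or_gt (I.r y) d with h | h
  · have h1 := hj.adjRelease_le hy h
    have h2 := I.adjRelease_le h0 y
    rw [Jobs.adjRelease, if_neg hact] at h1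
    linarith
  · linarith [hj.1.2]

theorem Jobs.MaySelect.add_lam_le (hj : I.MaySelect S d j)
    (hact : S.active ≠ some (I.typ j)) {y : Fin n} (hy : y ∉ S.done) (hyd : I.r y ≤ d)
    (hact' : S.active = some (I.typ y)) : I.r j + S.lam ≤ I.r y := by
  have h1 := hj.adjRelease_le hy hyd
  rwa [Jobs.adjRelease, if_neg hact, Jobs.adjRelease, if_pos hact'] at h1

theorem Jobs.startTime_le (hs : 0 ≤ s) : I.startTime s S d j ≤ d + s := by
  unfold Jobs.startTime; split_ifs <;> linarith

theorem Jobs.process_lam_of_le (h : α * S.lam ≤ I.startTime s S d j + I.p j - I.r j) :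
    (I.process s S d j).lam = 13 * S.lam :=
  if_pos h

theorem Jobs.process_lam_of_not_le (h : ¬ α * S.lam ≤ I.startTime s S d j + I.p j - I.r j) :
    (I.process s S d j).lam = S.lam :=
  if_neg h

theorem Jobs.mem_done_process {y : Fin n} :
    y ∈ (I.process s S d j).done ↔ y = j ∨ y ∈ S.done :=
  Finset.mem_insert

theorem Jobs.notMem_done_process {y : Fin n} :
    y ∉ (I.process s S d j).done ↔ y ≠ j ∧ y ∉ S.done := by
  rw [Jobs.mem_done_process, not_or]

theorem Jobs.process_time :
    (I.process s S d j).time = I.startTime s S d j + I.p j := rfl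

theorem Jobs.Reachable.lam_eq (hS : I.Reachable s S) : ∃ k : ℕ, S.lam = 13 ^ (k + 1) := by
  induction hS with
  | init => exact ⟨0, by simp [State.init, α]⟩
  | step S d j _ _ _ ih =>
    obtain ⟨k, hk⟩ := ih
    by_cases h : α * S.lam ≤ I.startTime s S d j + I.p j - I.r j
    · exact ⟨k + 1, by rw [Jobs.process_lam_of_le h, hk]; ring⟩
    · exact ⟨k, by rw [Jobs.process_lam_of_not_le h, hk]⟩

theorem Jobs.Reachable.lam_pos (hS : I.Reachable s S) : 0 < S.lam := by
  obtain ⟨k, hk⟩ := hS.lam_eq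
  rw [hk]; positivity

/-- A crude bound without any growth analysis; through `flow_le_card_mul` it gives the ratio of
order `n` used on the bad event. -/
theorem Jobs.Reachable.lag_le_card_mul (hs : 0 ≤ s) (hr : ∀ j, 0 ≤ I.r j)
    (hp : ∀ j, 0 < I.p j) (hQ : ∀ j, s + I.p j ≤ Q)
    (hS : I.Reachable s S) : ∀ y ∉ S.done, S.time - I.r y ≤ S.done.card * Q := by
  induction hS with
  | init => intro y _; simp [State.init, hr y]
  | step S d j _ hd hj ih =>
    intro y hy
    simp only [Jobs.process, Finset.mem_insert, not_or] at hy ⊢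
    rw [Finset.card_insert_of_notMem hj.1.1]
    have h1 := I.startTime_le hs (S := S) (d := d) (j := j)
    have h2 := hQ j
    have h3 := ih y hy.2
    have h4 : 0 ≤ (S.done.card : ℝ) * Q := by
      have := hp j
      have : 0 ≤ Q := by linarith
      positivity
    push_cast
    rcases hd.eq_or_le_release with h | h
    · linarith
    · linarith [h y hy.2]

theorem Jobs.Reachable.flow_le_card_mul (hs : 0 ≤ s) (hr : ∀ j, 0 ≤ I.r j)
    (hp : ∀ j, 0 < I.p j) (hQ : ∀ j, s + I.p j ≤ Q)
    (hS : I.Reachable s S) : ∀ y ∈ S.done, S.start y + I.p y - I.r y ≤ S.done.card * Q := by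
  induction hS with
  | init => intro y hy; simp [State.init] at hy
  | step S d j hS hd hj ih =>
    intro y hy
    have hQ0 : 0 ≤ Q := by linarith [hQ j, hp j]
    have h1 := I.startTime_le hs (S := S) (d := d) (j := j)
    have h2 := hQ j
    have h4 : 0 ≤ (S.done.card : ℝ) * Q := by positivity
    simp only [Jobs.process, Finset.mem_insert] at hy ⊢
    rw [Finset.card_insert_of_notMem hj.1.1]
    push_cast
    by_cases hyj : y = j
    · subst hyj
      rw [Function.update_self]
      rcases hd.eq_or_le_release with h | h
      · linarith [hS.lag_le_card_mul hs hr hp hQ y hj.1.1]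
      · linarith [h y hj.1.1]
    · rw [Function.update_of_ne hyj]
      linarith [ih y (hy.resolve_left hyj)]

/-- The work done since the last job that did not make the balance parameter grow. -/
theorem Jobs.Reachable.exists_work (hs : 0 ≤ s) (hr : ∀ j, 0 ≤ I.r j)
    (hQ0 : 0 ≤ Q) (hQ : ∀ j, s + I.p j ≤ Q) (hS : I.Reachable s S) :
    ∃ (a : ℝ) (J : Finset (Fin n)) (k : ℕ), S.lam = 13 ^ (k + 1) ∧ J ⊆ S.done ∧
      (∀ i ∈ J, a ≤ I.r i) ∧ (∀ y ∉ S.done, a ≤ I.r y) ∧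
      (∀ i ∈ J, ∀ y ∉ S.done, I.r i ≤ I.r y + S.lam) ∧
      S.time ≤ a + 14 * S.lam + Q + ∑ i ∈ J, I.p i + s * k := by
  induction hS with
  | init =>
    refine ⟨0, ∅, 0, by simp [State.init, α], by simp, by simp, fun y _ => hr y, by simp, ?_⟩
    simp [State.init, α]; linarith
  | step S d j hS hd hj ih =>
    obtain ⟨a, J, k, hk, hJ, haJ, ha, hJr, hT⟩ := ih
    have h0 := hS.lam_pos
    have h1 := I.startTime_le hs (S := S) (d := d) (j := j)
    have h2 := hQ j
    by_cases h : α * S.lam ≤ I.startTime s S d j + I.p j - I.r j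
    · rcases hd.eq_or_le_release with hdT | hdr
      -- Every job of `J` enlarged the parameter, so `J` accounts for at most `k` setups.
      · refine ⟨a, insert j J, k + 1, ?_, ?_, ?_, ?_, ?_, ?_⟩
        · rw [Jobs.process_lam_of_le h, hk]; ring
        · exact Finset.insert_subset_insert _ hJ
        · intro i hi
          rcases Finset.mem_insert.1 hi with rfl | hi
          · exact ha _ hj.1.1
          · exact haJ i hi
        · intro y hy
          simp only [Jobs.process, Finset.mem_insert, not_or] at hy
          exact ha y hy.2
        · intro i hi y hy
          rw [Jobs.notMem_done_process] at hy
          rw [Jobs.process_lam_of_le h]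
          rcases Finset.mem_insert.1 hi with rfl | hi
          · linarith [hj.release_le h0.le hy.2]
          · linarith [hJr i hi y hy.2]
        · rw [Finset.sum_insert (fun hjJ => hj.1.1 (hJ hjJ))]
          rw [Jobs.process_lam_of_le h, Jobs.process_time]
          push_cast
          linarith
      · refine ⟨d, ∅, k + 1, ?_, by simp, by simp, ?_, by simp, ?_⟩
        · rw [Jobs.process_lam_of_le h, hk]; ring
        · intro y hy
          simp only [Jobs.process, Finset.mem_insert, not_or] at hy
          exact hdr y hy.2
        · rw [Jobs.process_lam_of_le h, Jobs.process_time]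
          have : 0 ≤ s * ((k + 1 : ℕ) : ℝ) := by positivity
          simp only [Finset.sum_empty]
          linarith
    -- The flow time of `j` is below `13 * lam`, and `j` is released at most `lam` after any waiting
    -- job, so all waiting jobs are younger than `14 * lam`.
    · refine ⟨I.startTime s S d j + I.p j - 14 * S.lam - Q, ∅, k, ?_, by simp, by simp, ?_,
        by simp, ?_⟩
      · rw [Jobs.process_lam_of_not_le h, hk]
      · intro y hy
        simp only [Jobs.process, Finset.mem_insert, not_or] at hy
        have := hj.release_le h0.le hy.2
        simp only [α, not_le] at h
        linarith
      · rw [Jobs.process_lam_of_not_le h, Jobs.process_time]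
        have : 0 ≤ s * (k : ℝ) := by positivity
        simp only [Finset.sum_empty]
        linarith

/-- Growth steps are logarithmic in the parameter, so their setups cost at most one more `lam` plus
a constant. -/
theorem mul_natCast_le_sq_add_pow (s : ℝ) (k : ℕ) : s * k ≤ s ^ 2 + 13 ^ (k + 1) := by
  have h1 : (k : ℝ) ^ 2 ≤ 13 ^ (k + 1) := by
    have h : k ^ 2 ≤ 13 ^ (k + 1) := by
      have h2 : k < 2 ^ k := Nat.lt_two_pow_self
      calc k ^ 2 ≤ (2 ^ k) ^ 2 := Nat.pow_le_pow_left h2.le 2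
        _ = 4 ^ k := by rw [← pow_mul, mul_comm, pow_mul]; norm_num
        _ ≤ 13 ^ k := Nat.pow_le_pow_left (by norm_num) k
        _ ≤ 13 ^ (k + 1) := Nat.pow_le_pow_right (by norm_num) (by omega)
    exact_mod_cast h
  nlinarith [sq_nonneg (s - k)]

variable {t : Fin n → ℝ}

/-- The jobs of `J` are released in `[a, r y + lam]`, so the offline schedule bounds their work.
Here `16 = 14 + 1 + 1`: the start of the segment, the overhang of that interval, and the setups. -/
theorem Jobs.Reachable.lag_le (hs : 0 ≤ s) (hr : ∀ j, 0 ≤ I.r j)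
    (hp : ∀ j, 0 < I.p j) (hQ0 : 0 ≤ Q) (hQ : ∀ j, s + I.p j ≤ Q) (ht : I.Feasible s t)
    (hΦ0 : 0 ≤ Φ) (hΦ : ∀ j, t j + I.p j - I.r j ≤ Φ) (hS : I.Reachable s S) :
    ∀ y ∉ S.done, S.time - I.r y ≤ 16 * S.lam + (Q + Φ + s ^ 2) := by
  intro y hy
  obtain ⟨a, J, k, hk, hJ, haJ, ha, hJr, hT⟩ := hS.exists_work hs hr hQ0 hQ
  have h0 := hS.lam_pos
  have h1 := mul_natCast_le_sq_add_pow s k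
  have h2 := ht.work_le hs hp hΦ0 hΦ (by linarith [ha y hy]) haJ (fun i hi => hJr i hi y hy)
  rw [← hk] at h1
  linarith

theorem Jobs.Reachable.flow_le (hs : 0 ≤ s) (hr : ∀ j, 0 ≤ I.r j)
    (hp : ∀ j, 0 < I.p j) (hQ0 : 0 ≤ Q) (hQ : ∀ j, s + I.p j ≤ Q) (ht : I.Feasible s t)
    (hΦ0 : 0 ≤ Φ) (hΦ : ∀ j, t j + I.p j - I.r j ≤ Φ) (hS : I.Reachable s S) :
    ∀ y ∈ S.done, S.start y + I.p y - I.r y ≤ 16 * S.lam + (2 * Q + Φ + s ^ 2) := by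
  induction hS with
  | init => intro y hy; simp [State.init] at hy
  | step S d j hS hd hj ih =>
    intro y hy
    have h0 := hS.lam_pos
    have h1 := I.startTime_le hs (S := S) (d := d) (j := j)
    have h2 := hQ j
    have h3 : S.lam ≤ (I.process s S d j).lam := by
      by_cases h : α * S.lam ≤ I.startTime s S d j + I.p j - I.r j
      · rw [Jobs.process_lam_of_le h]; linarith
      · rw [Jobs.process_lam_of_not_le h]
    refine le_trans ?_ (add_le_add_left (mul_le_mul_of_nonneg_left h3 (by norm_num : (0:ℝ) ≤ 16)) _)
    simp only [Jobs.process, Finset.mem_insert] at hy ⊢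
    by_cases hyj : y = j
    · subst hyj
      rw [Function.update_self]
      rcases hd.eq_or_le_release with h | h
      · linarith [hS.lag_le hs hr hp hQ0 hQ ht hΦ0 hΦ y hj.1.1]
      · nlinarith [h y hj.1.1]
    · rw [Function.update_of_ne hyj]
      exact ih y (hy.resolve_left hyj)

end Balance

/-! ### Busy periods of Balance, and overload as the cause of growth. -/

section Segment

variable {I : Jobs n} {s Φ Q : ℝ} {S : State n} {d : ℝ} {j : Fin n} {t : Fin n → ℝ}

/-- Since the last time when all waiting jobs were younger than `4 * lam`, Balance has processed
the jobs in `J`, which were released from `a` on, and it has performed setups for the jobs in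
`O`. -/
structure Jobs.IsBusySince (I : Jobs n) (s : ℝ) (S : State n) (a : ℝ) (J O : Finset (Fin n)) :
    Prop where
  subset_done : J ⊆ S.done
  setups_subset : O ⊆ J
  le_release : ∀ i ∈ J, a ≤ I.r i
  le_release_of_notMem : ∀ y ∉ S.done, a ≤ I.r y
  release_le : ∀ i ∈ J, ∀ y ∉ S.done, I.r i ≤ I.r y + S.lam
  setup_release_le : ∀ o ∈ O, ∀ y ∉ S.done, I.r o ≤ I.r y
  setup_add_le : ∀ o ∈ O, ∀ y ∉ S.done, I.typ o = I.typ y → S.active ≠ some (I.typ o) →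
    I.r o + S.lam ≤ I.r y
  spread : I.Spread S.lam O
  time_le : S.time ≤ a + 4 * S.lam + ∑ i ∈ J, I.p i + s * O.card

theorem Jobs.isBusySince_empty (h : ∀ y ∉ S.done, S.time - 4 * S.lam ≤ I.r y) :
    I.IsBusySince s S (S.time - 4 * S.lam) ∅ ∅ where
  subset_done := by simp
  setups_subset := by simp
  le_release := by simp
  le_release_of_notMem := h
  release_le := by simp
  setup_release_le := by simp
  setup_add_le := by simp
  spread := by simp [Jobs.Spread]
  time_le := by simp

/-- A step of Balance without a setup. -/
theorem Jobs.IsBusySince.process_same {a : ℝ} {J O : Finset (Fin n)}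
    (h : I.IsBusySince s S a J O) (h0 : 0 ≤ S.lam) (hj : I.MaySelect S S.time j)
    (hlam : ¬ α * S.lam ≤ I.startTime s S S.time j + I.p j - I.r j)
    (hact : S.active = some (I.typ j)) :
    I.IsBusySince s (I.process s S S.time j) a (insert j J) O := by
  have hl := Jobs.process_lam_of_not_le hlam
  have hjJ : j ∉ J := fun hjJ => hj.1.1 (h.subset_done hjJ)
  constructor
  · exact Finset.insert_subset_insert _ h.subset_done
  · exact h.setups_subset.trans (Finset.subset_insert _ _)
  · intro i hi
    rcases Finset.mem_insert.1 hi with rfl | hi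
    · exact h.le_release_of_notMem _ hj.1.1
    · exact h.le_release i hi
  · exact fun y hy => h.le_release_of_notMem y (Jobs.notMem_done_process.1 hy).2
  · intro i hi y hy
    rw [hl]
    rcases Finset.mem_insert.1 hi with rfl | hi
    · exact hj.release_le h0 (Jobs.notMem_done_process.1 hy).2
    · exact h.release_le i hi y (Jobs.notMem_done_process.1 hy).2
  · exact fun o ho y hy => h.setup_release_le o ho y (Jobs.notMem_done_process.1 hy).2
  · intro o ho y hy hty hac
    rw [hl]
    refine h.setup_add_le o ho y (Jobs.notMem_done_process.1 hy).2 hty ?_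
    rw [hact]
    exact hac
  · rw [hl]; exact h.spread
  · rw [hl, Jobs.process_time, Finset.sum_insert hjJ, Jobs.startTime, if_pos hact]
    linarith [h.time_le]

/-- A step of Balance with a setup, while an old job is waiting. -/
theorem Jobs.IsBusySince.process_setup {a : ℝ} {J O : Finset (Fin n)}
    (h : I.IsBusySince s S a J O) (h0 : 0 ≤ S.lam) (hj : I.MaySelect S S.time j)
    (hlam : ¬ α * S.lam ≤ I.startTime s S S.time j + I.p j - I.r j)
    (hact : S.active ≠ some (I.typ j)) {z : Fin n} (hz : z ∉ S.done)
    (hzT : I.r z + S.lam ≤ S.time) :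
    I.IsBusySince s (I.process s S S.time j) a (insert j J) (insert j O) := by
  have hl := Jobs.process_lam_of_not_le hlam
  have hjJ : j ∉ J := fun hjJ => hj.1.1 (h.subset_done hjJ)
  have hjO : j ∉ O := fun hjO => hjJ (h.setups_subset hjO)
  have hsp : ∀ o ∈ O, I.typ o = I.typ j → I.r o + S.lam ≤ I.r j := fun o ho hty =>
    h.setup_add_le o ho j hj.1.1 hty (by rw [hty]; exact hact)
  constructor
  · exact Finset.insert_subset_insert _ h.subset_done
  · exact Finset.insert_subset_insert _ h.setups_subset
  · intro i hi
    rcases Finset.mem_insert.1 hi with rfl | hi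
    · exact h.le_release_of_notMem _ hj.1.1
    · exact h.le_release i hi
  · exact fun y hy => h.le_release_of_notMem y (Jobs.notMem_done_process.1 hy).2
  · intro i hi y hy
    rw [hl]
    rcases Finset.mem_insert.1 hi with rfl | hi
    · exact hj.release_le h0 (Jobs.notMem_done_process.1 hy).2
    · exact h.release_le i hi y (Jobs.notMem_done_process.1 hy).2
  · intro o ho y hy
    rcases Finset.mem_insert.1 ho with rfl | ho
    · exact hj.release_le_of_setup h0 hact (Jobs.notMem_done_process.1 hy).2
    · exact h.setup_release_le o ho y (Jobs.notMem_done_process.1 hy).2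
  · intro o ho y hy hty hac
    rw [hl]
    have hy' := (Jobs.notMem_done_process.1 hy).2
    rcases Finset.mem_insert.1 ho with rfl | ho
    · exact absurd rfl hac
    -- In the first case the machine leaves the type of `o`. As `o` was the oldest waiting job at
    -- its setup, `r o ≤ r j`. A released `y` would be preferred to `j` unless `r j + lam ≤ r y`; an
    -- unreleased `y` is at least `lam` younger than `z`, and `r j ≤ r z`.
    by_cases hao : S.active = some (I.typ o)
    · have hoj := h.setup_release_le o ho j hj.1.1
      rcases le_or_gt (I.r y) S.time with hyT | hyT
      · have := hj.add_lam_le hact hy' hyT (by rw [hao, hty])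
        linarith
      · have := hj.release_le_of_setup h0 hact hz
        linarith
    · exact h.setup_add_le o ho y hy' hty hao
  · rw [hl]
    intro i hi k hk hik hty
    rcases Finset.mem_insert.1 hi with hij | hi'
    · rcases Finset.mem_insert.1 hk with hkj | hk'
      · exact absurd (hij.trans hkj.symm) hik
      · rw [le_abs, hij]
        left
        linarith [hsp k hk' (by rw [← hty, hij])]
    · rcases Finset.mem_insert.1 hk with hkj | hk'
      · rw [le_abs, hkj]
        right
        linarith [hsp i hi' (by rw [hty, hkj])]
      · exact h.spread i hi' k hk' hik hty
  · rw [hl, Jobs.process_time, Finset.sum_insert hjJ, Finset.card_insert_of_notMem hjO,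
      Jobs.startTime, if_neg hact]
    push_cast
    linarith [h.time_le]

theorem Jobs.Reachable.exists_isBusySince (hs : 0 ≤ s) (hr : ∀ j, 0 ≤ I.r j)
    (hp : ∀ j, 0 < I.p j) (hQ0 : 0 ≤ Q) (hQ : ∀ j, s + I.p j ≤ Q) (ht : I.Feasible s t)
    (hΦ0 : 0 ≤ Φ) (hΦ : ∀ j, t j + I.p j - I.r j ≤ Φ) (hS : I.Reachable s S) :
    2 * Q + Φ + s ^ 2 ≤ S.lam → ∃ a J O, I.IsBusySince s S a J O := by
  induction hS with
  | init =>
    intro _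
    refine ⟨_, _, _, Jobs.isBusySince_empty fun y _ => ?_⟩
    have := hr y
    simp [State.init, α]
    linarith
  | step S d j hS hd hj ih =>
    intro hH
    have h0 := hS.lam_pos
    have h1 := I.startTime_le hs (S := S) (d := d) (j := j)
    have h2 := hQ j
    have hs2 := sq_nonneg s
    by_cases hreset : ∀ y ∉ (I.process s S d j).done,
        (I.process s S d j).time - 4 * (I.process s S d j).lam ≤ I.r y
    · exact ⟨_, _, _, Jobs.isBusySince_empty hreset⟩
    push Not at hreset
    obtain ⟨z, hz, hzT⟩ := hreset
    have hz' := (Jobs.notMem_done_process.1 hz).2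
    rw [Jobs.process_time] at hzT
    have hdT : d = S.time := by
      rcases hd.eq_or_le_release with h | h
      · exact h
      · linarith [h z hz']
    subst hdT
    -- Growth always begins a new segment: the lag is at most `16 * lam + 2 * Q + Φ + s ^ 2 ≤ 29 *
    -- lam` for the old `lam`, whereas a job `z` would need a lag above `4 * (13 * lam)`. Hence the
    -- parameter is constant within a segment.
    by_cases h : α * S.lam ≤ I.startTime s S S.time j + I.p j - I.r j
    · rw [Jobs.process_lam_of_le h] at hH hzT
      linarith [hS.lag_le hs hr hp hQ0 hQ ht hΦ0 hΦ z hz']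
    · rw [Jobs.process_lam_of_not_le h] at hH hzT
      obtain ⟨a, J, O, hB⟩ := ih hH
      by_cases hact : S.active = some (I.typ j)
      · exact ⟨_, _, _, hB.process_same h0.le hj h hact⟩
      · exact ⟨_, _, _, hB.process_setup h0.le hj h hact hz' (by linarith)⟩

/-- There are jobs whose processing times, together with setups for a spread set of jobs, exceed
the length of the interval between the release times of `x` and `y` considerably. -/
def Jobs.IsOverloaded (I : Jobs n) (s lam : ℝ) (x y : Fin n) : Prop :=
  I.r x ≤ I.r y + lam ∧ ∃ J O : Finset (Fin n), O ⊆ J ∧ I.Spread lam O ∧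
    (∀ i ∈ J, I.r x ≤ I.r i) ∧ (∀ i ∈ J, I.r i ≤ I.r y + lam) ∧
    I.r y + lam - I.r x + 7 * lam ≤ ∑ i ∈ J, I.p i + s * O.card

/-- The excess is `7 = 12 - 4 - 1`: the lag of `j`, minus the initial backlog, minus the overhang of
the release interval. The interval begins at the earliest release in `J`, so its endpoints come from
two jobs, which keeps the union bound finite. -/
theorem Jobs.IsBusySince.isOverloaded {a : ℝ} {J O : Finset (Fin n)}
    (h : I.IsBusySince s S a J O) (h0 : 0 < S.lam) (hj : j ∉ S.done)
    (hlag : I.r j + 12 * S.lam ≤ S.time) : ∃ x, I.IsOverloaded s S.lam x j := by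
  have hT := h.time_le
  have haj := h.le_release_of_notMem j hj
  rcases J.eq_empty_or_nonempty with rfl | hJ
  · have : O = ∅ := Finset.subset_empty.1 h.setups_subset
    subst this
    simp at hT
    linarith
  · obtain ⟨x, hx, hmin⟩ := J.exists_min_image I.r hJ
    have hax := h.le_release x hx
    exact ⟨x, h.release_le x hx j hj, J, O, h.setups_subset, h.spread, hmin,
      fun i hi => h.release_le i hi j hj, by linarith⟩

/-- Growth from a value above `Θ` needs a flow time of `13 * lam`. At most `Q ≤ lam` of it is setup
and processing, which leaves a lag of `12 * lam`. -/
theorem Jobs.Reachable.lam_le_or_isOverloaded (hs : 0 ≤ s) (hr : ∀ j, 0 ≤ I.r j)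
    (hp : ∀ j, 0 < I.p j) (hQ0 : 0 ≤ Q) (hQ : ∀ j, s + I.p j ≤ Q) (ht : I.Feasible s t)
    (hΦ0 : 0 ≤ Φ) (hΦ : ∀ j, t j + I.p j - I.r j ≤ Φ) {Θ : ℝ} (hΘ : 2 * Q + Φ + s ^ 2 ≤ Θ)
    (hΘ1 : 1 ≤ Θ) (hS : I.Reachable s S) :
    S.lam ≤ 13 * Θ ∨ ∃ k : ℕ, Θ ≤ 13 ^ (k + 1) ∧ ∃ x y, I.IsOverloaded s (13 ^ (k + 1)) x y := by
  induction hS with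
  | init => left; simp [State.init, α]; linarith
  | step S d j hS hd hj ih =>
    rcases ih with ih | ih
    · by_cases h : α * S.lam ≤ I.startTime s S d j + I.p j - I.r j
      · rw [Jobs.process_lam_of_le h]
        rcases le_or_gt S.lam Θ with hle | hlt
        · left; linarith
        · right
          obtain ⟨a, J, O, hB⟩ := hS.exists_isBusySince hs hr hp hQ0 hQ ht hΦ0 hΦ (by linarith)
          obtain ⟨k, hk⟩ := hS.lam_eq
          have h1 := I.startTime_le hs (S := S) (d := d) (j := j)
          have h2 := hQ j
          have h3 := hS.lam_pos
          have h4 := sq_nonneg s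
          simp only [α] at h
          have hlag : I.r j + 12 * S.lam ≤ S.time := by
            rcases hd.eq_or_le_release with hd | hd
            · linarith
            · linarith [hd j hj.1.1]
          obtain ⟨x, hx⟩ := hB.isOverloaded h3 hj.1.1 hlag
          exact ⟨k, by rw [← hk]; exact hlt.le, x, j, by rw [← hk]; exact hx⟩
      · rw [Jobs.process_lam_of_not_le h]
        exact Or.inl ih
    · exact Or.inr ih

end Segment

/-! ### Cutting an overloaded interval into windows with little slack. -/

section Windows

open Classical in
/-- The largest size of a spread set of jobs in `W`. -/
def Jobs.spreadNum (I : Jobs n) (lam : ℝ) (W : Finset (Fin n)) : ℕ :=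
  (W.powerset.filter (I.Spread lam)).sup Finset.card

/-- The jobs released in the `i`-th interval of length `L` after `a`. -/
def Jobs.window (I : Jobs n) (L a : ℝ) (i : ℕ) : Finset (Fin n) :=
  {j | a + i * L ≤ I.r j ∧ I.r j < a + (i + 1) * L}

/-- How much the work released in a window falls short of the most that a good offline schedule
can handle. -/
def Jobs.slack (I : Jobs n) (s lam Φ L a : ℝ) (i : ℕ) : ℝ :=
  L + Φ + 4 * s * L / lam - s * I.spreadNum lam (I.window L a i) - ∑ j ∈ I.window L a i, I.p j

variable {I : Jobs n} {s Φ lam L a : ℝ} {t : Fin n → ℝ}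

theorem Jobs.mem_window {i : ℕ} {j : Fin n} :
    j ∈ I.window L a i ↔ a + i * L ≤ I.r j ∧ I.r j < a + (i + 1) * L := by
  simp [Jobs.window]

theorem Jobs.window_disjoint (hL : 0 ≤ L) {i k : ℕ} (hik : i ≠ k) :
    Disjoint (I.window L a i) (I.window L a k) := by
  rw [Finset.disjoint_left]
  intro j hi hk
  rw [Jobs.mem_window] at hi hk
  rcases lt_or_gt_of_ne hik with h | h
  · have : (i : ℝ) + 1 ≤ k := by exact_mod_cast h
    nlinarith
  · have : (k : ℝ) + 1 ≤ i := by exact_mod_cast h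
    nlinarith

theorem Jobs.card_le_spreadNum {O W : Finset (Fin n)} (hO : I.Spread lam O) (hW : O ⊆ W) :
    O.card ≤ I.spreadNum lam W := by
  classical
  unfold Jobs.spreadNum
  exact Finset.le_sup (f := Finset.card)
    (Finset.mem_filter.2 ⟨Finset.mem_powerset.2 hW, hO⟩)

theorem Jobs.exists_card_eq_spreadNum (I : Jobs n) (lam : ℝ) (W : Finset (Fin n)) :
    ∃ O ⊆ W, I.Spread lam O ∧ O.card = I.spreadNum lam W := by
  classical
  unfold Jobs.spreadNum
  obtain ⟨O, hO, h⟩ := Finset.exists_mem_eq_sup (W.powerset.filter (I.Spread lam))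
    ⟨∅, by simp [Jobs.Spread]⟩ Finset.card
  rw [Finset.mem_filter, Finset.mem_powerset] at hO
  exact ⟨O, hO.1, hO.2, h.symm⟩

theorem Jobs.spreadNum_le_card (I : Jobs n) (lam : ℝ) (W : Finset (Fin n)) :
    I.spreadNum lam W ≤ W.card := by
  obtain ⟨O, hO, -, h⟩ := I.exists_card_eq_spreadNum lam W
  exact h ▸ Finset.card_le_card hO

theorem Jobs.Feasible.slack_nonneg (hs : 0 ≤ s) (hp : ∀ j, 0 < I.p j)
    (ht : I.Feasible s t) (hΦ0 : 0 ≤ Φ) (hΦ : ∀ j, t j + I.p j - I.r j ≤ Φ) (hlam0 : 0 < lam)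
    (hlam : Φ ≤ lam / 2) (hL : lam ≤ L) (a : ℝ) (i : ℕ) : 0 ≤ I.slack s lam Φ L a i := by
  obtain ⟨O, hOW, hO, hcard⟩ := I.exists_card_eq_spreadNum lam (I.window L a i)
  have h := ht.work_add_setups_le' hs hp hΦ0 hΦ hlam0 hlam hO hOW (u := a + i * L)
    (v := a + (i + 1) * L) (by nlinarith) (fun j hj => (Jobs.mem_window.1 hj).1)
    (fun j hj => (Jobs.mem_window.1 hj).2.le)
  have h1 : a + (i + 1) * L - (a + i * L) = L := by ring
  rw [h1, hcard] at h
  have h2 : 1 ≤ L / lam := (one_le_div hlam0).2 hL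
  have h3 : s * (2 + 2 * L / lam) ≤ 4 * s * L / lam := by
    have e1 : 4 * s * L / lam = s * (4 * (L / lam)) := by ring
    have e2 : 2 * L / lam = 2 * (L / lam) := by ring
    rw [e1, e2]
    apply mul_le_mul_of_nonneg_left _ hs
    linarith
  unfold Jobs.slack
  linarith

theorem Jobs.work_before_le (hs : 0 ≤ s) (hp : ∀ j, 0 < I.p j) (hL : 0 ≤ L)
    {O J : Finset (Fin n)} (hO : I.Spread lam O) (hOJ : O ⊆ J) (hJ : ∀ j ∈ J, a ≤ I.r j)
    (m : ℕ) :
    ∑ j ∈ J with I.r j < a + m * L, I.p j + s * (O.filter fun j => I.r j < a + m * L).card ≤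
      ∑ i ∈ Finset.range m,
        (∑ j ∈ I.window L a i, I.p j + s * I.spreadNum lam (I.window L a i)) := by
  induction m with
  | zero =>
    have h1 : (J.filter fun j => I.r j < a + (0 : ℕ) * L) = ∅ := by
      rw [Finset.filter_eq_empty_iff]
      intro j hj
      simpa using hJ j hj
    have h2 : (O.filter fun j => I.r j < a + (0 : ℕ) * L) = ∅ := by
      rw [Finset.filter_eq_empty_iff]
      intro j hj
      simpa using hJ j (hOJ hj)
    rw [h1, h2]
    simp
  | succ m ih =>
    rw [Finset.sum_range_succ]
    have key : ∀ K : Finset (Fin n), (K.filter fun j => I.r j < a + ((m + 1 : ℕ) : ℝ) * L) =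
        (K.filter fun j => I.r j < a + m * L) ∪ (K ∩ I.window L a m) := by
      intro K
      ext j
      simp only [Finset.mem_filter, Finset.mem_union, Finset.mem_inter, Jobs.mem_window]
      push_cast
      constructor
      · rintro ⟨h1, h2⟩
        rcases lt_or_ge (I.r j) (a + m * L) with h | h
        · exact Or.inl ⟨h1, h⟩
        · exact Or.inr ⟨h1, h, h2⟩
      · rintro (⟨h1, h2⟩ | ⟨h1, h2, h3⟩)
        · exact ⟨h1, by linarith⟩
        · exact ⟨h1, h3⟩
    have hdis : ∀ K : Finset (Fin n),
        Disjoint (K.filter fun j => I.r j < a + m * L) (K ∩ I.window L a m) := by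
      intro K
      rw [Finset.disjoint_left]
      intro j h1 h2
      have h3 := (Jobs.mem_window.1 (Finset.mem_inter.1 h2).2).1
      have h4 := (Finset.mem_filter.1 h1).2
      linarith
    rw [key J, key O, Finset.sum_union (hdis J), Finset.card_union_of_disjoint (hdis O)]
    have h1 : ∑ j ∈ J ∩ I.window L a m, I.p j ≤ ∑ j ∈ I.window L a m, I.p j :=
      Finset.sum_le_sum_of_subset_of_nonneg Finset.inter_subset_right fun j _ _ => (hp j).le
    have h2 : ((O ∩ I.window L a m).card : ℝ) ≤ I.spreadNum lam (I.window L a m) := by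
      exact_mod_cast Jobs.card_le_spreadNum (hO.mono Finset.inter_subset_left)
        Finset.inter_subset_right
    have h3 := mul_le_mul_of_nonneg_left h2 hs
    push_cast
    linarith

/-- Beyond the full windows there remains a piece shorter than `L`, where the offline schedule
admits an excess of at most `Φ + lam`. So at least `7 * lam - lam - lam / 2` of the excess lies in
the full windows. -/
theorem Jobs.Feasible.sum_slack_le (hs : 0 ≤ s) (hp : ∀ j, 0 < I.p j)
    (ht : I.Feasible s t) (hΦ0 : 0 ≤ Φ) (hΦ : ∀ j, t j + I.p j - I.r j ≤ Φ) (hlam0 : 0 < lam)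
    (hlam : Φ ≤ lam / 2) (hL : lam ≤ L) (hsL : 4 * s * L ≤ lam ^ 2) {x y : Fin n}
    (h : I.IsOverloaded s lam x y) :
    ∑ i ∈ Finset.range ⌊(I.r y + lam - I.r x) / L⌋₊, I.slack s lam Φ L (I.r x) i ≤
      ⌊(I.r y + lam - I.r x) / L⌋₊ * (Φ + 4 * s * L / lam) - 5 * lam := by
  obtain ⟨hxy, J, O, hOJ, hO, hJx, hJy, hw⟩ := h
  have hL0 : 0 < L := by linarith
  set m := ⌊(I.r y + lam - I.r x) / L⌋₊ with hm
  have hm1 : m * L ≤ I.r y + lam - I.r x := by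
    have := Nat.floor_le (a := (I.r y + lam - I.r x) / L) (div_nonneg (by linarith) hL0.le)
    rwa [le_div_iff₀ hL0] at this
  have hm2 : I.r y + lam - I.r x < (m + 1) * L := by
    have := Nat.lt_floor_add_one ((I.r y + lam - I.r x) / L)
    rwa [div_lt_iff₀ hL0] at this
  have h1 := Jobs.work_before_le hs hp hL0.le hO hOJ hJx m
  have h2 := ht.work_add_setups_le' hs hp hΦ0 hΦ hlam0 hlam
    (O := O.filter fun j => ¬ I.r j < I.r x + m * L) (J := J.filter fun j => ¬ I.r j < I.r x + m * L)
    (hO.mono (Finset.filter_subset _ _)) (Finset.filter_subset_filter _ hOJ)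
    (u := I.r x + m * L) (v := I.r y + lam) (by linarith)
    (fun j hj => not_lt.1 (Finset.mem_filter.1 hj).2)
    (fun j hj => hJy j (Finset.mem_filter.1 hj).1)
  have h3 := Finset.sum_filter_add_sum_filter_not J (fun j => I.r j < I.r x + m * L) I.p
  have h4 : ((O.filter fun j => I.r j < I.r x + m * L).card : ℝ) +
      (O.filter fun j => ¬ I.r j < I.r x + m * L).card = O.card := by
    exact_mod_cast Finset.card_filter_add_card_filter_not (s := O) _
  have h5 : ∑ i ∈ Finset.range m, I.slack s lam Φ L (I.r x) i =
      m * (L + Φ + 4 * s * L / lam) - ∑ i ∈ Finset.range m,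
        (∑ j ∈ I.window L (I.r x) i, I.p j + s * I.spreadNum lam (I.window L (I.r x) i)) := by
    simp only [Jobs.slack, Finset.sum_sub_distrib, Finset.sum_add_distrib, Finset.sum_const,
      Finset.card_range, nsmul_eq_mul]
    ring
  have h6 : s * (2 + 2 * (I.r y + lam - (I.r x + m * L)) / lam) ≤ lam := by
    have e1 : 2 * (I.r y + lam - (I.r x + m * L)) / lam ≤ 2 * L / lam := by
      gcongr; linarith
    have e2 : 2 ≤ 2 * L / lam := by
      rw [le_div_iff₀ hlam0]; linarith
    calc s * (2 + 2 * (I.r y + lam - (I.r x + m * L)) / lam)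
        ≤ s * (2 * L / lam + 2 * L / lam) := by gcongr
      _ = 4 * s * L / lam := by ring
      _ ≤ lam := by rw [div_le_iff₀ hlam0]; linarith
  rw [h5]
  rw [← h3, ← h4] at hw
  linarith

/-- The excess must come from saved setups, which forces an interval of length of order `lam ^ 2 /
s`. But `n` jobs with `p j ≤ Φ` cannot fill more than `n * (Φ + s)`. This bounds the number of
relevant parameters by a multiple of `n`, whatever the processing times are. -/
theorem Jobs.Feasible.lam_le_of_isOverloaded (hs : 0 ≤ s) (hp : ∀ j, 0 < I.p j)
    (ht : I.Feasible s t) (hΦ0 : 0 ≤ Φ) (hΦ : ∀ j, t j + I.p j - I.r j ≤ Φ) (hlam1 : 1 ≤ lam)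
    (hlam : Φ ≤ lam / 2) (hsl : s ≤ lam) {x y : Fin n} (h : I.IsOverloaded s lam x y) :
    lam ≤ s * (1 + s) * n := by
  obtain ⟨hxy, J, O, hOJ, hO, hJx, hJy, hw⟩ := h
  have hlam0 : 0 < lam := by linarith
  have h1 := ht.work_add_setups_le' hs hp hΦ0 hΦ hlam0 hlam hO hOJ (by linarith) hJx hJy
  have hcard : ∀ K : Finset (Fin n), (K.card : ℝ) ≤ n := fun K => by
    exact_mod_cast (Finset.card_le_univ K).trans_eq (Fintype.card_fin n)
  have h2 : ∑ j ∈ J, I.p j ≤ n * Φ := by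
    calc ∑ j ∈ J, I.p j ≤ ∑ j ∈ J, Φ :=
          Finset.sum_le_sum fun j _ => by linarith [hΦ j, ht.release j]
      _ = J.card * Φ := by simp
      _ ≤ n * Φ := by gcongr; exact_mod_cast hcard J
  have h3 : s * O.card ≤ s * n := by gcongr; exact_mod_cast hcard O
  set ℓ := I.r y + lam - I.r x with hℓ
  have h4 : 4.5 * lam ≤ s * (2 * ℓ / lam) := by nlinarith
  have h5 : 4.5 * lam ^ 2 ≤ 2 * s * ℓ := by
    have : s * (2 * ℓ / lam) = 2 * s * ℓ / lam := by ring
    rw [this, le_div_iff₀ hlam0] at h4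
    nlinarith
  have h6 : ℓ ≤ n * (lam * (1 + s)) := by
    have : (n : ℝ) * (Φ + s) ≤ n * (lam * (1 + s)) := by
      gcongr; nlinarith
    nlinarith
  have h7 : s * ℓ ≤ s * (n * (lam * (1 + s))) := by gcongr
  have h8 : lam * lam ≤ (s * (1 + s) * n) * lam := by nlinarith
  exact le_of_mul_le_mul_right h8 hlam0

end Windows

/-! ### Anticoncentration of window loads and an exponential moment bound. -/

section Probability

open MeasureTheory ProbabilityTheory

/-- `μ` is concentrated on `[-1, 1]`, has mean `0`, variance `v` and kurtosis at most `K`. -/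
structure MomentBounds (μ : Measure ℝ) (v K : ℝ) : Prop where
  abs_le : ∀ᵐ x ∂μ, |x| ≤ 1
  mean : ∫ x, x ∂μ = 0
  variance : ∫ x, x ^ 2 ∂μ = v
  fourth : ∫ x, x ^ 4 ∂μ ≤ K * v ^ 2

theorem ae_pi_forall {μ : Measure ℝ} [IsProbabilityMeasure μ] {p : ℝ → Prop}
    (h : ∀ᵐ x ∂μ, p x) : ∀ᵐ x ∂(Measure.pi fun _ : Fin n => μ), ∀ j, p (x j) :=
  ae_all_iff.2 fun j => (Measure.quasiMeasurePreserving_eval (fun _ : Fin n => μ) j).ae h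

theorem integral_eval_pi {μ : Measure ℝ} [IsProbabilityMeasure μ] (j : Fin n) {f : ℝ → ℝ}
    (hf : Measurable f) :
    ∫ x, f (x j) ∂(Measure.pi fun _ : Fin n => μ) = ∫ u, f u ∂μ := by
  have h := measurePreserving_eval (fun _ : Fin n => μ) j
  have h1 := integral_map (μ := Measure.pi fun _ : Fin n => μ) (f := f) h.measurable.aemeasurable
    hf.aestronglyMeasurable
  rw [h.map_eq] at h1
  exact h1.symm

theorem integral_add_pow_of_indepFun {Ω : Type*} [MeasurableSpace Ω] {P : Measure Ω}
    [IsProbabilityMeasure P] {Y Z : Ω → ℝ} (hY : Measurable Y) (hZ : Measurable Z)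
    {B : ℝ} (hYB : ∀ᵐ ω ∂P, |Y ω| ≤ B) (hZB : ∀ᵐ ω ∂P, |Z ω| ≤ B) (hYZ : IndepFun Y Z P)
    (hY0 : ∫ ω, Y ω ∂P = 0) (hZ0 : ∫ ω, Z ω ∂P = 0) :
    ∫ ω, (Y ω + Z ω) ^ 2 ∂P = ∫ ω, Y ω ^ 2 ∂P + ∫ ω, Z ω ^ 2 ∂P ∧
    ∫ ω, (Y ω + Z ω) ^ 4 ∂P =
      ∫ ω, Y ω ^ 4 ∂P + 6 * ((∫ ω, Y ω ^ 2 ∂P) * ∫ ω, Z ω ^ 2 ∂P) + ∫ ω, Z ω ^ 4 ∂P := by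
  have hmul : ∀ i k : ℕ, ∫ ω, Y ω ^ i * Z ω ^ k ∂P = (∫ ω, Y ω ^ i ∂P) * ∫ ω, Z ω ^ k ∂P := by
    intro i k
    exact (hYZ.comp (measurable_id.pow_const i) (measurable_id.pow_const k)
      ).integral_fun_mul_eq_mul_integral (hY.pow_const i).aestronglyMeasurable
      (hZ.pow_const k).aestronglyMeasurable
  have hint : ∀ i k : ℕ, Integrable (fun ω => Y ω ^ i * Z ω ^ k) P := by
    intro i k
    refine Integrable.of_bound ((hY.pow_const i).mul (hZ.pow_const k)).aestronglyMeasurable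
      (B ^ i * B ^ k) ?_
    filter_upwards [hYB, hZB] with ω h1 h2
    have h0 : 0 ≤ B := (abs_nonneg _).trans h1
    rw [Real.norm_eq_abs, abs_mul, abs_pow, abs_pow]
    gcongr
  constructor
  · have : ∀ ω, (Y ω + Z ω) ^ 2 =
        (Y ω ^ 2 * Z ω ^ 0 + 2 * (Y ω ^ 1 * Z ω ^ 1)) + Y ω ^ 0 * Z ω ^ 2 := fun ω => by ring
    simp_rw [this]
    rw [integral_add ((hint 2 0).fun_add ((hint 1 1).const_mul 2)) (hint 0 2),
      integral_add (hint 2 0) ((hint 1 1).const_mul 2), integral_const_mul, hmul, hmul, hmul]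
    simp [hY0]
  · have : ∀ ω, (Y ω + Z ω) ^ 4 =
        (((Y ω ^ 4 * Z ω ^ 0 + 4 * (Y ω ^ 3 * Z ω ^ 1)) + 6 * (Y ω ^ 2 * Z ω ^ 2)) +
          4 * (Y ω ^ 1 * Z ω ^ 3)) + Y ω ^ 0 * Z ω ^ 4 := fun ω => by ring
    simp_rw [this]
    have i1 := hint 4 0
    have i2 := (hint 3 1).const_mul 4
    have i3 := (hint 2 2).const_mul 6
    have i4 := (hint 1 3).const_mul 4
    rw [integral_add (((i1.fun_add i2).fun_add i3).fun_add i4) (hint 0 4),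
      integral_add ((i1.fun_add i2).fun_add i3) i4, integral_add (i1.fun_add i2) i3, integral_add i1 i2,
      integral_const_mul, integral_const_mul, integral_const_mul, hmul, hmul, hmul, hmul, hmul]
    simp [hY0, hZ0]

theorem measurable_sum_mul (p : Fin n → ℝ) (W : Finset (Fin n)) :
    Measurable fun x : Fin n → ℝ => ∑ j ∈ W, p j * x j :=
  Finset.measurable_sum _ fun j _ => (measurable_pi_apply j).const_mul _

theorem MomentBounds.ae_abs_sum_le {μ : Measure ℝ} [IsProbabilityMeasure μ] {v K : ℝ}
    (hμ : MomentBounds μ v K) (p : Fin n → ℝ) (W : Finset (Fin n)) :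
    ∀ᵐ x ∂(Measure.pi fun _ : Fin n => μ), |∑ j ∈ W, p j * x j| ≤ ∑ j ∈ W, |p j| := by
  filter_upwards [ae_pi_forall hμ.abs_le] with x hx
  refine (Finset.abs_sum_le_sum_abs _ _).trans (Finset.sum_le_sum fun j _ => ?_)
  rw [abs_mul]
  exact mul_le_of_le_one_right (abs_nonneg _) (hx j)

/-- The kurtosis bound passes to independent sums: the cross term `6 * a * b` of the fourth moment
is covered by `2 * K * a * b` because `3 ≤ K`. -/
theorem MomentBounds.moments_sum {μ : Measure ℝ} [IsProbabilityMeasure μ] {v K : ℝ}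
    (hμ : MomentBounds μ v K) (hK : 3 ≤ K) (p : Fin n → ℝ) (W : Finset (Fin n)) :
    ∫ x, (∑ j ∈ W, p j * x j) ∂(Measure.pi fun _ : Fin n => μ) = 0 ∧
    ∫ x, (∑ j ∈ W, p j * x j) ^ 2 ∂(Measure.pi fun _ : Fin n => μ) = v * ∑ j ∈ W, p j ^ 2 ∧
    ∫ x, (∑ j ∈ W, p j * x j) ^ 4 ∂(Measure.pi fun _ : Fin n => μ) ≤
      K * (v * ∑ j ∈ W, p j ^ 2) ^ 2 := by
  have hv : 0 ≤ v := hμ.variance ▸ integral_nonneg fun x => sq_nonneg x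
  induction W using Finset.induction_on with
  | empty => simp
  | insert i W hi ih =>
    obtain ⟨h1, h2, h4⟩ := ih
    set P := Measure.pi fun _ : Fin n => μ with hP
    have hYm := measurable_sum_mul p W
    have hZm : Measurable fun x : Fin n → ℝ => p i * x i := (measurable_pi_apply i).const_mul _
    have hind : IndepFun (fun x : Fin n → ℝ => ∑ j ∈ W, p j * x j) (fun x => p i * x i) P := by
      have := (iIndepFun_pi (μ := fun _ : Fin n => μ) (X := fun j (u : ℝ) => p j * u)
        fun j => (measurable_id.const_mul (p j)).aemeasurable).indepFun_finsetSum_of_notMem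
        (fun j => (measurable_pi_apply j).const_mul _) hi
      convert this using 1
      ext x
      simp
    have e1 : ∫ x, p i * x i ∂P = 0 := by
      rw [integral_eval_pi i (f := fun u => p i * u) (measurable_id.const_mul _),
        integral_const_mul, hμ.mean, mul_zero]
    have e2 : ∫ x, (p i * x i) ^ 2 ∂P = p i ^ 2 * v := by
      rw [integral_eval_pi i (f := fun u => (p i * u) ^ 2) ((measurable_id.const_mul _).pow_const 2)]
      simp_rw [mul_pow]
      rw [integral_const_mul, hμ.variance]
    have e4 : ∫ x, (p i * x i) ^ 4 ∂P ≤ p i ^ 4 * (K * v ^ 2) := by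
      rw [integral_eval_pi i (f := fun u => (p i * u) ^ 4) ((measurable_id.const_mul _).pow_const 4)]
      simp_rw [mul_pow]
      rw [integral_const_mul]
      exact mul_le_mul_of_nonneg_left hμ.fourth (by positivity)
    have hYb := hμ.ae_abs_sum_le p W
    have hZb := hμ.ae_abs_sum_le p {i}
    simp only [Finset.sum_singleton] at hZb
    have hW0 : 0 ≤ ∑ j ∈ W, |p j| := Finset.sum_nonneg fun j _ => abs_nonneg _
    obtain ⟨k2, k4⟩ := integral_add_pow_of_indepFun hYm hZm (B := ∑ j ∈ W, |p j| + |p i|)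
      (hYb.mono fun x hx => hx.trans (le_add_of_nonneg_right (abs_nonneg _)))
      (hZb.mono fun x hx => hx.trans (le_add_of_nonneg_left hW0)) hind h1 e1
    simp_rw [Finset.sum_insert hi, add_comm (p i * _)]
    refine ⟨?_, ?_, ?_⟩
    · rw [integral_add, h1, e1, add_zero]
      · exact Integrable.of_bound hYm.aestronglyMeasurable _ hYb
      · exact Integrable.of_bound hZm.aestronglyMeasurable _ hZb
    · rw [k2, h2, e2]; ring
    · rw [k4, h2, e2]
      have h0 : 0 ≤ ∑ j ∈ W, p j ^ 2 := Finset.sum_nonneg fun j _ => sq_nonneg _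
      have : 0 ≤ v * (∑ j ∈ W, p j ^ 2) * (p i ^ 2 * v) := by positivity
      nlinarith

/-- A Paley–Zygmund inequality. -/
theorem le_measureReal_half_le {Ω : Type*} [MeasurableSpace Ω] {P : Measure Ω}
    [IsProbabilityMeasure P] {U : Ω → ℝ} (hU : Measurable U) (hU2 : Integrable (fun ω => U ω ^ 2) P)
    (hU1 : Integrable U P) {A K : ℝ} (hA : 0 < A) (hK : 0 < K) (h1 : ∫ ω, U ω ∂P = A)
    (h2 : ∫ ω, U ω ^ 2 ∂P ≤ K * A ^ 2) : 1 / (4 * K) ≤ P.real {ω | A / 2 ≤ U ω} := by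
  set G := {ω | A / 2 ≤ U ω} with hG
  have hGm : MeasurableSet G := measurableSet_le measurable_const hU
  -- On `G` this is the AM-GM inequality `U ≤ U ^ 2 / (4 * K * A) + K * A`. Integrating leaves `A /
  -- 4 ≤ K * A * P G`.
  have hpt : ∀ ω, U ω ≤ A / 2 + (1 / (4 * K * A)) * U ω ^ 2 + G.indicator (fun _ => K * A) ω := by
    intro ω
    have hKA : 0 < K * A := by positivity
    have h3 : 0 ≤ 1 / (4 * K * A) * U ω ^ 2 := by positivity
    by_cases h : ω ∈ G
    · rw [Set.indicator_of_mem h]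
      have : 1 / (4 * K * A) * U ω ^ 2 + K * A - U ω = (U ω - 2 * (K * A)) ^ 2 / (4 * K * A) := by
        field_simp; ring
      have h4 : 0 ≤ (U ω - 2 * (K * A)) ^ 2 / (4 * K * A) := by positivity
      linarith
    · rw [Set.indicator_of_notMem h]
      have : U ω < A / 2 := not_le.1 h
      linarith
  have hint : Integrable (G.indicator fun _ => K * A) P :=
    (integrable_const _).indicator hGm
  have hint2 := (integrable_const (μ := P) (A / 2)).fun_add (hU2.const_mul (1 / (4 * K * A)))
  have h3 := integral_mono hU1 (hint2.fun_add hint) hpt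
  rw [integral_add hint2 hint,
    integral_add (integrable_const _) (hU2.const_mul _), integral_const_mul,
    integral_indicator_const _ hGm, h1] at h3
  simp at h3
  have h4 : (4 * K * A)⁻¹ * ∫ ω, U ω ^ 2 ∂P ≤ (4 * K * A)⁻¹ * (K * A ^ 2) := by gcongr
  have h5 : (4 * K * A)⁻¹ * (K * A ^ 2) = A / 4 := by field_simp
  have h8 : A⁻¹ * (K⁻¹ * 4⁻¹) = (4 * K * A)⁻¹ := by
    rw [mul_inv, mul_inv]; ring
  rw [h8] at h3
  have h6 : 1 / 4 * A ≤ (P.real G * K) * A := by linarith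
  have h7 := le_of_mul_le_mul_right h6 hA
  rw [div_le_iff₀ (by positivity)]
  linarith

/-- Linear forms with large variance are not concentrated in short intervals. -/
theorem MomentBounds.le_measureReal_abs_sub {μ : Measure ℝ} [IsProbabilityMeasure μ] {v K : ℝ}
    (hμ : MomentBounds μ v K) (hK : 3 ≤ K) (p : Fin n → ℝ) (W : Finset (Fin n)) {d : ℝ}
    (hd : 0 < d) (hV : d ^ 2 ≤ v * ∑ j ∈ W, p j ^ 2) (c : ℝ) :
    1 / (32 * K) ≤ (Measure.pi fun _ : Fin n => μ).real
      {x | d / 2 < |c - ∑ j ∈ W, p j * x j|} := by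
  obtain ⟨h1, h2, h4⟩ := hμ.moments_sum hK p W
  set P := Measure.pi fun _ : Fin n => μ with hP
  set V := v * ∑ j ∈ W, p j ^ 2 with hVdef
  have hYm := measurable_sum_mul p W
  have hYb := hμ.ae_abs_sum_le p W
  set B := ∑ j ∈ W, |p j|
  have hV0 : 0 < V := lt_of_lt_of_le (by positivity) hV
  have hUm : Measurable fun x : Fin n → ℝ => (c - ∑ j ∈ W, p j * x j) ^ 2 :=
    (measurable_const.sub hYm).pow_const 2
  have hint : ∀ k : ℕ, Integrable (fun x : Fin n → ℝ => (∑ j ∈ W, p j * x j) ^ k) P := fun k => by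
    refine Integrable.of_bound (hYm.pow_const k).aestronglyMeasurable (B ^ k) ?_
    filter_upwards [hYb] with x hx
    rw [Real.norm_eq_abs, abs_pow]
    gcongr
  have hint' : ∀ k : ℕ, Integrable (fun x : Fin n → ℝ => (c - ∑ j ∈ W, p j * x j) ^ k) P :=
    fun k => by
    refine Integrable.of_bound ((measurable_const.sub hYm).pow_const k).aestronglyMeasurable
      ((|c| + B) ^ k) ?_
    filter_upwards [hYb] with x hx
    rw [Real.norm_eq_abs, abs_pow]
    gcongr
    exact (abs_sub _ _).trans (by gcongr)
  have m2 : ∫ x, (c - ∑ j ∈ W, p j * x j) ^ 2 ∂P = V + c ^ 2 := by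
    have : ∀ x : Fin n → ℝ, (c - ∑ j ∈ W, p j * x j) ^ 2 =
        (∑ j ∈ W, p j * x j) ^ 2 + ((-2 * c) * (∑ j ∈ W, p j * x j) ^ 1 + c ^ 2) :=
      fun x => by ring
    simp_rw [this]
    rw [integral_add (hint 2) (((hint 1).const_mul _).fun_add (integrable_const _)),
      integral_add ((hint 1).const_mul _) (integrable_const _), integral_const_mul, h2]
    simp [h1]
  have m4 : ∫ x, ((c - ∑ j ∈ W, p j * x j) ^ 2) ^ 2 ∂P ≤ (8 * K) * (V + c ^ 2) ^ 2 := by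
    calc ∫ x, ((c - ∑ j ∈ W, p j * x j) ^ 2) ^ 2 ∂P
        ≤ ∫ x, (8 * (∑ j ∈ W, p j * x j) ^ 4 + 8 * c ^ 4) ∂P := by
          refine integral_mono ?_ (((hint 4).const_mul 8).add (integrable_const _)) fun x => ?_
          · simp_rw [← pow_mul]
            exact hint' 4
          · simp only
            generalize ∑ j ∈ W, p j * x j = y
            nlinarith [sq_nonneg (c + y), sq_nonneg (c - y), sq_nonneg (c ^ 2 - y ^ 2),
              sq_nonneg ((c + y) ^ 2), mul_nonneg (sq_nonneg (c + y)) (sq_nonneg (c - y)),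
              mul_nonneg (sq_nonneg (c + y)) (sq_nonneg c),
              mul_nonneg (sq_nonneg (c + y)) (sq_nonneg y)]
      _ ≤ 8 * (K * V ^ 2) + 8 * c ^ 4 := by
          rw [integral_add ((hint 4).const_mul 8) (integrable_const _), integral_const_mul]
          simp
          linarith
      _ ≤ (8 * K) * (V + c ^ 2) ^ 2 := by
          have : 0 ≤ V * c ^ 2 := by positivity
          nlinarith [sq_nonneg (c ^ 2), mul_nonneg (by linarith : (0:ℝ) ≤ K) this,
            mul_nonneg (by linarith : (0:ℝ) ≤ K - 1) (sq_nonneg (c ^ 2))]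
  have hc2 := sq_nonneg c
  -- Applied to the square `(c - Y) ^ 2`, whose mean `V + c ^ 2` is at least `d ^ 2` for every `c`;
  -- half of it exceeds `(d / 2) ^ 2`.
  have h5 := le_measureReal_half_le hUm (by simp_rw [← pow_mul]; exact hint' 4) (hint' 2)
    (by linarith : 0 < V + c ^ 2) (by linarith : 0 < 8 * K) m2 m4
  have h6 : 1 / (32 * K) = 1 / (4 * (8 * K)) := by ring
  rw [h6]
  refine h5.trans (measureReal_mono fun x hx => ?_)
  simp only [Set.mem_ofPred_eq] at hx ⊢
  refine lt_of_pow_lt_pow_left₀ 2 (abs_nonneg _) ?_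
  rw [sq_abs]
  nlinarith

theorem lintegral_mul_of_dependsOn {μ : Measure ℝ} [IsProbabilityMeasure μ]
    {f g : (Fin n → ℝ) → ℝ≥0∞} (hf : Measurable f) (hg : Measurable g) {S T : Finset (Fin n)}
    (hST : Disjoint S T) (hfS : DependsOn f (S : Set (Fin n)))
    (hgT : DependsOn g (T : Set (Fin n))) :
    ∫⁻ x, f x * g x ∂(Measure.pi fun _ : Fin n => μ) =
      (∫⁻ x, f x ∂(Measure.pi fun _ : Fin n => μ)) *
        ∫⁻ x, g x ∂(Measure.pi fun _ : Fin n => μ) := by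
  have hind := (iIndepFun_pi (μ := fun _ : Fin n => μ) (X := fun _ (u : ℝ) => u)
    fun j => aemeasurable_id).indepFun_finset S T hST fun j => measurable_pi_apply j
  -- Extension by `0` factors `f` and `g` through disjoint sets of coordinates.
  let ext (A : Finset (Fin n)) (y : A → ℝ) : Fin n → ℝ :=
    fun i => if h : i ∈ A then y ⟨i, h⟩ else 0
  have hext : ∀ A, Measurable (ext A) := by
    intro A
    refine measurable_pi_lambda _ fun i => ?_
    by_cases h : i ∈ A
    · simp only [ext, dif_pos h]; exact measurable_pi_apply _
    · simp only [ext, dif_neg h]; exact measurable_const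
  have key := hind.comp (hf.comp (hext S)) (hg.comp (hext T))
  have hfe : (f ∘ ext S) ∘ (fun (a : Fin n → ℝ) (i : S) => a i) = f := by
    funext x
    refine hfS fun i hi => ?_
    have : i ∈ S := hi
    simp [ext, this]
  have hge : (g ∘ ext T) ∘ (fun (a : Fin n → ℝ) (i : T) => a i) = g := by
    funext x
    refine hgT fun i hi => ?_
    have : i ∈ T := hi
    simp [ext, this]
  rw [hfe, hge] at key
  exact lintegral_mul_eq_lintegral_mul_lintegral_of_indepFun'' hf.aemeasurable hg.aemeasurable key

theorem lintegral_prod_le_pow {μ : Measure ℝ} [IsProbabilityMeasure μ]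
    {h : ℕ → (Fin n → ℝ) → ℝ≥0∞} (hm : ∀ i, Measurable (h i)) {W : ℕ → Finset (Fin n)}
    (hW : ∀ i k, i ≠ k → Disjoint (W i) (W k))
    (hdep : ∀ i, DependsOn (h i) (W i : Set (Fin n))) {c : ℝ≥0∞}
    (hc : ∀ i, ∫⁻ x, h i x ∂(Measure.pi fun _ : Fin n => μ) ≤ c) (m : ℕ) :
    ∫⁻ x, ∏ i ∈ Finset.range m, h i x ∂(Measure.pi fun _ : Fin n => μ) ≤ c ^ m := by
  induction m with
  | zero => simp
  | succ m ih =>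
    simp_rw [Finset.prod_range_succ]
    rw [lintegral_mul_of_dependsOn (S := (Finset.range m).biUnion W) (T := W m)
      (Finset.measurable_prod _ fun i _ => hm i) (hm m), pow_succ]
    · gcongr
      exact hc m
    · rw [Finset.disjoint_biUnion_left]
      exact fun i hi => hW i m (Finset.mem_range.1 hi).ne
    · intro x y hxy
      refine Finset.prod_congr rfl fun i hi => hdep i fun j hj => hxy j ?_
      exact Finset.mem_coe.2 (Finset.mem_biUnion.2 ⟨i, hi, hj⟩)
    · exact hdep m

/-- Independent variables `D i` that take small positive values with probability at most `1 - q`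
are unlikely to be all nonnegative with a small sum. -/
theorem measure_nonneg_sum_le {μ : Measure ℝ} [IsProbabilityMeasure μ] {q d : ℝ} (hd : 0 < d)
    {D : ℕ → (Fin n → ℝ) → ℝ} (hD : ∀ i, Measurable (D i)) {W : ℕ → Finset (Fin n)}
    (hW : ∀ i k, i ≠ k → Disjoint (W i) (W k))
    (hdep : ∀ i, DependsOn (D i) (W i : Set (Fin n)))
    (hq : ∀ i, q ≤ (Measure.pi fun _ : Fin n => μ).real {x | D i x < 0 ∨ d ≤ D i x}) (m : ℕ) :
    (Measure.pi fun _ : Fin n => μ) {x | (∀ i ∈ Finset.range m, 0 ≤ D i x) ∧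
      ∑ i ∈ Finset.range m, D i x ≤ m * (q * d / 8)} ≤ ENNReal.ofReal (Real.exp (-(m * q / 2))) := by
  set P := Measure.pi fun _ : Fin n => μ with hP
  -- The indicator in `h i` encodes nonnegativity. Since `exp (-1) ≤ 3 / 8`, each mean is at most `1
  -- - 5 / 8 * q`. On the event the product is at least `exp (-(m * q / 8))`, so Markov's inequality
  -- gives the exponent `1 / 8 - 5 / 8 = -1 / 2`.
  let h : ℕ → (Fin n → ℝ) → ℝ≥0∞ := fun i x =>
    if 0 ≤ D i x then ENNReal.ofReal (Real.exp (-(D i x / d))) else 0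
  have hm : ∀ i, Measurable (h i) := fun i =>
    Measurable.ite (measurableSet_le measurable_const (hD i))
      (Real.measurable_exp.comp ((hD i).div_const d).neg).ennreal_ofReal measurable_const
  have hhdep : ∀ i, DependsOn (h i) (W i : Set (Fin n)) := by
    intro i x y hxy
    simp only [h, hdep i hxy]
  have hexp1 : Real.exp (-1) ≤ 3 / 8 := by
    have := Real.exp_one_gt_d9
    rw [Real.exp_neg]
    rw [inv_le_comm₀ (Real.exp_pos _) (by norm_num)]
    linarith
  have hc : ∀ i, ∫⁻ x, h i x ∂P ≤ ENNReal.ofReal (Real.exp (-(5 / 8 * q))) := by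
    intro i
    set G := {x | D i x < 0 ∨ d ≤ D i x} with hG
    have hGm : MeasurableSet G := (measurableSet_lt (hD i) measurable_const).union
      (measurableSet_le measurable_const (hD i))
    have hGi : Integrable (G.indicator (1 : (Fin n → ℝ) → ℝ)) P :=
      (integrable_const (1 : ℝ)).indicator hGm
    calc ∫⁻ x, h i x ∂P ≤ ∫⁻ x, ENNReal.ofReal (1 - 5 / 8 * G.indicator 1 x) ∂P := by
          refine lintegral_mono fun x => ?_
          simp only [h]
          split_ifs with h0
          · apply ENNReal.ofReal_le_ofReal
            by_cases hx : x ∈ G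
            · have hdx : d ≤ D i x := hx.resolve_left (not_lt.2 h0)
              rw [Set.indicator_of_mem hx]
              have : Real.exp (-(D i x / d)) ≤ Real.exp (-1) := by
                apply Real.exp_le_exp.2
                have := (one_le_div hd).2 hdx
                linarith
              simp only [Pi.one_apply]
              linarith
            · rw [Set.indicator_of_notMem hx]
              have : Real.exp (-(D i x / d)) ≤ 1 := by
                apply Real.exp_le_one_iff.2
                have := div_nonneg h0 hd.le
                linarith
              linarith
          · exact zero_le
      _ = ENNReal.ofReal (∫ x, (1 - 5 / 8 * G.indicator 1 x) ∂P) := by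
          rw [ofReal_integral_eq_lintegral_ofReal]
          · exact (integrable_const _).sub
              (hGi.const_mul (5 / 8))
          · refine Filter.Eventually.of_forall fun x => ?_
            by_cases hx : x ∈ G <;> (simp [hx]; try norm_num)
      _ ≤ ENNReal.ofReal (Real.exp (-(5 / 8 * q))) := by
          apply ENNReal.ofReal_le_ofReal
          rw [integral_sub (integrable_const _)
            (hGi.const_mul (5 / 8)), integral_const_mul]
          have e : ∫ x, G.indicator (1 : (Fin n → ℝ) → ℝ) x ∂P = P.real G :=
            integral_indicator_one hGm
          rw [e]
          simp
          have h1 := hq i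
          have h2 := Real.add_one_le_exp (-(5 / 8 * q))
          linarith
  have hprod := lintegral_prod_le_pow hm hW hhdep hc m
  rw [← hP] at hprod
  set E := {x | (∀ i ∈ Finset.range m, 0 ≤ D i x) ∧
      ∑ i ∈ Finset.range m, D i x ≤ m * (q * d / 8)} with hE
  set c0 := ENNReal.ofReal (Real.exp (-(m * q / 8))) with hc0
  have hmark := mul_meas_ge_le_lintegral (μ := P)
    (f := fun x => ∏ i ∈ Finset.range m, h i x) (Finset.measurable_prod _ fun i _ => hm i) c0
  have hsub : E ⊆ {x | c0 ≤ ∏ i ∈ Finset.range m, h i x} := by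
    rintro x ⟨hx1, hx2⟩
    have : ∏ i ∈ Finset.range m, h i x =
        ∏ i ∈ Finset.range m, ENNReal.ofReal (Real.exp (-(D i x / d))) :=
      Finset.prod_congr rfl fun i hi => by simp only [h, if_pos (hx1 i hi)]
    simp only [Set.mem_ofPred_eq]
    rw [this, ← ENNReal.ofReal_prod_of_nonneg fun i _ => (Real.exp_pos _).le, ← Real.exp_sum]
    apply ENNReal.ofReal_le_ofReal
    apply Real.exp_le_exp.2
    rw [Finset.sum_neg_distrib, ← Finset.sum_div]
    have : (∑ i ∈ Finset.range m, D i x) / d ≤ m * q / 8 := by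
      rw [div_le_iff₀ hd]; linarith
    linarith
  have h1 : c0 * P E ≤ ENNReal.ofReal (Real.exp (-(5 / 8 * q))) ^ m :=
    (mul_le_mul_right (measure_mono hsub) c0).trans (hmark.trans hprod)
  rw [← ENNReal.ofReal_pow (Real.exp_pos _).le, ← Real.exp_nat_mul] at h1
  have h2 : ENNReal.ofReal (Real.exp (m * q / 8)) * c0 = 1 := by
    rw [hc0, ← ENNReal.ofReal_mul (Real.exp_pos _).le, ← Real.exp_add]
    simp
  calc P E = ENNReal.ofReal (Real.exp (m * q / 8)) * (c0 * P E) := by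
        rw [← mul_assoc, h2, one_mul]
    _ ≤ ENNReal.ofReal (Real.exp (m * q / 8)) *
        ENNReal.ofReal (Real.exp (m * -(5 / 8 * q))) := by gcongr
    _ = ENNReal.ofReal (Real.exp (-(m * q / 2))) := by
        rw [← ENNReal.ofReal_mul (Real.exp_pos _).le, ← Real.exp_add]
        congr 2
        ring

end Probability

/-! ### The bad event, its probability, and Balance outside it. -/

section BadEvent

open MeasureTheory ProbabilityTheory

variable {I : Jobs n} {s q δ v lam : ℝ}

/-- The length of the windows for the balance parameter `lam`. -/
def windowLength (s δ v lam : ℝ) : ℝ :=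
  max lam (2 * (2 + s) * (δ * lam) ^ 2 / v)

/-- The perturbations for which all of the first `m` windows after `a` have nonnegative slack, but
the total slack is small. -/
def Jobs.crowded (I : Jobs n) (s q δ v lam a : ℝ) (m : ℕ) : Set (Fin n → ℝ) :=
  {x | (∀ i ∈ Finset.range m,
      0 ≤ (I.perturb x).slack s lam (q * δ * lam / 16) (windowLength s δ v lam) a i) ∧
    ∑ i ∈ Finset.range m,
      (I.perturb x).slack s lam (q * δ * lam / 16) (windowLength s δ v lam) a i ≤
        m * (q * (δ * lam) / 8)}

/-- The number of full windows between the release time of `y` and `lam` after that of `z`. -/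
def Jobs.numWindows (I : Jobs n) (s δ v lam : ℝ) (y z : Fin n) : ℕ :=
  ⌊(I.r z + lam - I.r y) / windowLength s δ v lam⌋₊

/-- The perturbations for which the balance parameter might get too large. -/
def Jobs.badEvent (I : Jobs n) (s q δ v : ℝ) : Set (Fin n → ℝ) :=
  ⋃ k ∈ Finset.range ⌈s * (1 + s) * n⌉₊, ⋃ y ∈ (Finset.univ : Finset (Fin n)),
    ⋃ z ∈ (Finset.univ : Finset (Fin n)),
      {x | 40 / (q * δ) ≤ I.numWindows s δ v (13 ^ (k + 1)) y z ∧
        x ∈ I.crowded s q δ v (13 ^ (k + 1)) (I.r y) (I.numWindows s δ v (13 ^ (k + 1)) y z)}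

theorem Jobs.slack_perturb (I : Jobs n) (s lam Φ L a : ℝ) (i : ℕ) (x : Fin n → ℝ) :
    (I.perturb x).slack s lam Φ L a i =
      I.slack s lam Φ L a i - ∑ j ∈ I.window L a i, I.p j * x j := by
  have : ∑ j ∈ I.window L a i, (1 + x j) * I.p j =
      ∑ j ∈ I.window L a i, I.p j + ∑ j ∈ I.window L a i, I.p j * x j := by
    rw [← Finset.sum_add_distrib]
    exact Finset.sum_congr rfl fun j _ => by ring
  change L + Φ + 4 * s * L / lam - s * I.spreadNum lam (I.window L a i) -
    ∑ j ∈ I.window L a i, (1 + x j) * I.p j = _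
  rw [this, Jobs.slack]
  ring

/-- If the load has standard deviation at least `d`, the slack avoids `[0, d]` with constant
probability. Otherwise `1 ≤ p j` gives `∑ p j ≤ ∑ p j ^ 2 ≤ d ^ 2 / v`. Work, perturbation and
setups then fill at most half of the window, and the slack is almost surely at least `d`. The second
term of `windowLength` is chosen for this case. -/
theorem Jobs.le_measureReal_slack {μ : Measure ℝ} [IsProbabilityMeasure μ] {K : ℝ}
    (hI : I.Admissible) (hμ : MomentBounds μ v K) (hK : 3 ≤ K) (hv : 0 < v) (hs : 0 ≤ s)
    {Φ L d a : ℝ} (hΦ : 0 ≤ Φ) (hlam : 0 < lam) (hd : 0 < d) (hdL : d ≤ L / 2)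
    (hL : 2 * (2 + s) * d ^ 2 / v ≤ L) (i : ℕ) :
    1 / (32 * K) ≤ (Measure.pi fun _ : Fin n => μ).real
      {x | (I.perturb x).slack s lam Φ L a i < 0 ∨ d ≤ (I.perturb x).slack s lam Φ L a i} := by
  rcases le_or_gt (d ^ 2) (v * ∑ j ∈ I.window L a i, I.p j ^ 2) with h | h
  · refine (hμ.le_measureReal_abs_sub hK I.p (I.window L a i) hd h
      (I.slack s lam Φ L a i - d / 2)).trans (measureReal_mono fun x hx => ?_)
    simp only [Set.mem_ofPred_eq, I.slack_perturb] at hx ⊢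
    rcases lt_abs.1 hx with h | h
    · right; linarith
    · left; linarith
  · have hae : ∀ᵐ x ∂(Measure.pi fun _ : Fin n => μ),
        d ≤ (I.perturb x).slack s lam Φ L a i := by
      filter_upwards [hμ.ae_abs_sum_le I.p (I.window L a i)] with x hx
      rw [I.slack_perturb]
      set W := I.window L a i
      have h1 : ∑ j ∈ W, |I.p j| = ∑ j ∈ W, I.p j :=
        Finset.sum_congr rfl fun j _ => abs_of_nonneg (by linarith [hI.1 j])
      have h2 : ∑ j ∈ W, I.p j ≤ ∑ j ∈ W, I.p j ^ 2 :=
        Finset.sum_le_sum fun j _ => by nlinarith [hI.1 j]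
      have h3 : (W.card : ℝ) ≤ ∑ j ∈ W, I.p j := by
        calc (W.card : ℝ) = ∑ j ∈ W, (1 : ℝ) := by simp
          _ ≤ _ := Finset.sum_le_sum fun j _ => hI.1 j
      have h4 : (I.spreadNum lam W : ℝ) ≤ W.card := by exact_mod_cast I.spreadNum_le_card lam W
      have h5 : s * I.spreadNum lam W ≤ s * ∑ j ∈ W, I.p j :=
        mul_le_mul_of_nonneg_left (h4.trans h3) hs
      have h6 : v * (2 * (2 + s) * ∑ j ∈ W, I.p j) ≤ v * L := by
        rw [div_le_iff₀ hv] at hL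
        have : v * ∑ j ∈ W, I.p j ≤ d ^ 2 := by nlinarith
        nlinarith
      have h7 := le_of_mul_le_mul_left h6 hv
      have h8 : 0 ≤ 4 * s * L / lam := by
        apply div_nonneg _ hlam.le
        have : 0 ≤ L := by linarith
        positivity
      rw [h1] at hx
      have h9 := (abs_le.1 hx).2
      unfold Jobs.slack
      linarith
    have hone : (Measure.pi fun _ : Fin n => μ).real
        {x | (I.perturb x).slack s lam Φ L a i < 0 ∨ d ≤ (I.perturb x).slack s lam Φ L a i} =
        1 := by
      rw [measureReal_congr (Filter.eventuallyEq_univ.2 (hae.mono fun x hx => Or.inr hx)),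
        probReal_univ]
    rw [hone, div_le_one (by linarith)]
    linarith

theorem Jobs.measure_crowded_le {μ : Measure ℝ} [IsProbabilityMeasure μ] {K : ℝ}
    (hI : I.Admissible) (hμ : MomentBounds μ v K) (hK : 3 ≤ K) (hv : 0 < v) (hs : 0 ≤ s)
    (hq : q = 1 / (32 * K)) (hδ : 0 < δ) (hδ2 : δ ≤ 1 / 2) (hlam : 0 < lam) (a : ℝ) (m : ℕ) :
    (Measure.pi fun _ : Fin n => μ) (I.crowded s q δ v lam a m) ≤
      ENNReal.ofReal (Real.exp (-(m * q / 2))) := by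
  have hq0 : 0 < q := by rw [hq]; positivity
  have hL0 : lam ≤ windowLength s δ v lam := le_max_left _ _
  refine measure_nonneg_sum_le (d := δ * lam) (by positivity) (fun i => ?_)
    (W := I.window (windowLength s δ v lam) a)
    (fun i k hik => Jobs.window_disjoint (by linarith) hik) (fun i => ?_) (fun i => ?_) m
  · simp_rw [I.slack_perturb]
    exact measurable_const.sub (measurable_sum_mul _ _)
  · intro x y hxy
    simp only [I.slack_perturb]
    congr 1
    exact Finset.sum_congr rfl fun j hj => by rw [hxy j hj]
  · rw [hq]
    exact Jobs.le_measureReal_slack (L := windowLength s δ v lam) hI hμ hK hv hs (by positivity) hlam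
      (by positivity)
      (by
        have : δ * lam ≤ 1 / 2 * lam := by gcongr
        linarith) (le_max_right _ _) i

theorem Jobs.measure_badEvent_le {μ : Measure ℝ} [IsProbabilityMeasure μ] {K : ℝ}
    (hI : I.Admissible) (hμ : MomentBounds μ v K) (hK : 3 ≤ K) (hv : 0 < v) (hs : 0 ≤ s)
    (hq : q = 1 / (32 * K)) (hδ : 0 < δ) (hδ2 : δ ≤ 1 / 2) :
    (Measure.pi fun _ : Fin n => μ) (I.badEvent s q δ v) ≤
      ⌈s * (1 + s) * n⌉₊ * (n * (n * ENNReal.ofReal (Real.exp (-(20 / δ))))) := by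
  have hq0 : 0 < q := by rw [hq]; positivity
  have key : ∀ k y z, (Measure.pi fun _ : Fin n => μ)
      {x | 40 / (q * δ) ≤ I.numWindows s δ v (13 ^ (k + 1)) y z ∧
        x ∈ I.crowded s q δ v (13 ^ (k + 1)) (I.r y) (I.numWindows s δ v (13 ^ (k + 1)) y z)} ≤
      ENNReal.ofReal (Real.exp (-(20 / δ))) := by
    intro k y z
    by_cases h : 40 / (q * δ) ≤ I.numWindows s δ v (13 ^ (k + 1)) y z
    · refine (measure_mono fun x hx => hx.2).trans ((Jobs.measure_crowded_le hI hμ hK hv hs hq hδ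
        hδ2 (by positivity) _ _).trans (ENNReal.ofReal_le_ofReal (Real.exp_le_exp.2 ?_)))
      have h1 : 20 / δ = 40 / (q * δ) * q / 2 := by field_simp; norm_num
      rw [h1]
      gcongr
    · simp [h]
  unfold Jobs.badEvent
  refine (measure_biUnion_finset_le _ _).trans ?_
  refine (Finset.sum_le_card_nsmul _ _ _ fun k _ => ?_).trans (by
    rw [Finset.card_range, nsmul_eq_mul])
  refine (measure_biUnion_finset_le _ _).trans ?_
  refine (Finset.sum_le_card_nsmul _ _ _ fun y _ => ?_).trans (by
    rw [Finset.card_univ, Fintype.card_fin, nsmul_eq_mul])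
  refine (measure_biUnion_finset_le _ _).trans ?_
  exact (Finset.sum_le_card_nsmul _ _ _ fun z _ => key k y z).trans (by
    rw [Finset.card_univ, Fintype.card_fin, nsmul_eq_mul])

/-- The optimum depends on `x`, so it is replaced by the fixed bound `q * δ * lam / 16`; this makes
window slacks functions of disjoint coordinates. The terms `Φ` and `4 * s * L / lam` are both at
most this bound, hence the threshold `q * δ * lam / 8` per window. Nonnegative total slack then
needs `5 * lam ≤ m * (q * δ * lam / 8)`, the origin of `40 / (q * δ)`. -/
theorem Jobs.mem_badEvent {x : Fin n → ℝ} {k : ℕ} {y z : Fin n} {t : Fin n → ℝ} {Φ₀ : ℝ}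
    (hs : 0 ≤ s) (hp : ∀ j, 0 < (I.perturb x).p j) (ht : (I.perturb x).Feasible s t)
    (hΦ : ∀ j, t j + (I.perturb x).p j - (I.perturb x).r j ≤ Φ₀)
    (hq : 0 < q) (hq1 : q ≤ 1) (hδ : 0 < δ) (hδ1 : δ ≤ 1 / 2) (hv : 0 < v)
    (hδv : 128 * (s * (2 + s)) * δ ≤ q * v) (hΦ₀ : 0 ≤ Φ₀)
    (hlam : 16 / (q * δ) * (Φ₀ + 4 * s) ≤ 13 ^ (k + 1))
    (h : (I.perturb x).IsOverloaded s (13 ^ (k + 1)) y z) : x ∈ I.badEvent s q δ v := by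
  set lam : ℝ := 13 ^ (k + 1) with hlamdef
  have hlam1 : 1 ≤ lam := one_le_pow₀ (by norm_num)
  have hlam0 : 0 < lam := by linarith
  have hqδ : 0 < q * δ := by positivity
  have hqδ1 : q * δ ≤ 1 / 2 := by nlinarith
  have hΦs : Φ₀ + 4 * s ≤ q * δ * lam / 16 := by
    rw [div_mul_eq_mul_div, div_le_iff₀ hqδ] at hlam
    linarith
  have hΦle : ∀ j, t j + (I.perturb x).p j - (I.perturb x).r j ≤ q * δ * lam / 16 :=
    fun j => (hΦ j).trans (by linarith)
  have hΦ0 : 0 ≤ q * δ * lam / 16 := by positivity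
  have hqlam : q * δ * lam ≤ 1 / 2 * lam := by gcongr
  have hΦlam : q * δ * lam / 16 ≤ lam / 2 := by linarith
  have hsl : s ≤ lam := by linarith
  set L := windowLength s δ v lam with hL
  have hLlam : lam ≤ L := le_max_left _ _
  have hsL : 4 * s * L / lam ≤ q * δ * lam / 16 := by
    rw [div_le_iff₀ hlam0]
    -- For `L = lam` the term is `4 * s`, covered by `hΦs`; for the longer windows `hδv` is exactly
    -- what is needed.
    rcases max_cases lam (2 * (2 + s) * (δ * lam) ^ 2 / v) with h | h
    · rw [hL, windowLength, h.1]
      nlinarith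
    · rw [hL, windowLength, h.1]
      have e : 4 * s * (2 * (2 + s) * (δ * lam) ^ 2 / v) =
          (128 * (s * (2 + s)) * δ) * (δ * lam ^ 2 / 16) / v := by ring
      rw [e, div_le_iff₀ hv]
      calc 128 * (s * (2 + s)) * δ * (δ * lam ^ 2 / 16) ≤ q * v * (δ * lam ^ 2 / 16) := by gcongr
        _ = q * δ * lam / 16 * lam * v := by ring
  have hsL' : 4 * s * L ≤ lam ^ 2 := by
    rw [div_le_iff₀ hlam0] at hsL
    nlinarith
  have h1 := ht.lam_le_of_isOverloaded hs hp hΦ0 hΦle hlam1 hΦlam hsl h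
  have h2 := ht.sum_slack_le hs hp hΦ0 hΦle hlam0 hΦlam hLlam hsL' h
  have h3 := fun i => ht.slack_nonneg hs hp hΦ0 hΦle hlam0 hΦlam hLlam (I.r y) i
  set m := I.numWindows s δ v lam y z with hm
  change ∑ i ∈ Finset.range m, (I.perturb x).slack s lam (q * δ * lam / 16) L (I.r y) i ≤
    m * (q * δ * lam / 16 + 4 * s * L / lam) - 5 * lam at h2
  have h4 : 0 ≤ ∑ i ∈ Finset.range m,
      (I.perturb x).slack s lam (q * δ * lam / 16) L (I.r y) i :=
    Finset.sum_nonneg fun i _ => h3 i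
  have h5 : m * (q * δ * lam / 16 + 4 * s * L / lam) ≤ m * (q * (δ * lam) / 8) := by
    gcongr; linarith
  have hk : k < ⌈s * (1 + s) * n⌉₊ := by
    have e1 : (k : ℝ) < 13 ^ (k + 1) := by
      have : k < 13 ^ (k + 1) :=
        (Nat.lt_pow_self (by norm_num)).trans (Nat.pow_lt_pow_right (by norm_num) (by omega))
      exact_mod_cast this
    exact Nat.lt_ceil.2 (e1.trans_le h1)
  unfold Jobs.badEvent
  simp only [Set.mem_iUnion, Finset.mem_range, Finset.mem_univ]
  refine ⟨k, hk, y, trivial, z, trivial, ?_, fun i _ => h3 i, ?_⟩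
  · rw [div_le_iff₀ hqδ]
    have h6 : 5 * lam ≤ (m * (q * δ) / 8) * lam := by linarith
    have := le_of_mul_le_mul_right h6 hlam0
    linarith
  · exact h2.trans (by linarith)

/-- Outside the bad event, Balance is competitive. -/
theorem Jobs.IsBalanceSchedule.flow_le {x : Fin n → ℝ} {t t' : Fin n → ℝ} {Φ₀ : ℝ}
    (hI : I.Admissible) (hs : 0 ≤ s) (hp : ∀ j, 0 < (I.perturb x).p j)
    (ht : (I.perturb x).Feasible s t)
    (hΦ : ∀ j, t j + (I.perturb x).p j - (I.perturb x).r j ≤ Φ₀)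
    (hq : 0 < q) (hq1 : q ≤ 1) (hδ : 0 < δ) (hδ1 : δ ≤ 1 / 2) (hv : 0 < v)
    (hδv : 128 * (s * (2 + s)) * δ ≤ q * v) (hΦ₀ : 0 ≤ Φ₀) (hx : x ∉ I.badEvent s q δ v)
    (ht' : (I.perturb x).IsBalanceSchedule s t') (j : Fin n) :
    t' j + (I.perturb x).p j - (I.perturb x).r j ≤
      209 * (16 / (q * δ) * (Φ₀ + (4 * s + s ^ 2 + 1))) := by
  obtain ⟨S, hS, hdone, rfl⟩ := ht'
  have hr : ∀ j, 0 ≤ (I.perturb x).r j := hI.2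
  have hpΦ : ∀ j, (I.perturb x).p j ≤ Φ₀ := fun j => by linarith [hΦ j, ht.release j]
  have hQ : ∀ j, s + (I.perturb x).p j ≤ s + Φ₀ := fun j => by linarith [hpΦ j]
  have hQ0 : 0 ≤ s + Φ₀ := by linarith
  set A := 4 * s + s ^ 2 + 1 with hA
  set Θ := 16 / (q * δ) * (Φ₀ + A) with hΘ
  have hρ : 32 ≤ 16 / (q * δ) := by
    rw [le_div_iff₀ (by positivity)]; nlinarith
  have hs2 := sq_nonneg s
  have hΘ32 : 32 * (Φ₀ + A) ≤ Θ := by rw [hΘ]; gcongr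
  have hH : 2 * (s + Φ₀) + Φ₀ + s ^ 2 ≤ Θ := by linarith
  have h1 := hS.flow_le hs hr hp hQ0 hQ ht hΦ₀ hΦ j (by rw [hdone]; exact Finset.mem_univ _)
  rcases hS.lam_le_or_isOverloaded hs hr hp hQ0 hQ ht hΦ₀ hΦ hH (by linarith) with
    h | ⟨k, hk, y, z, h⟩
  -- Here `209 = 16 * 13 + 1`: the parameter is at most `13 * Θ`, and the additive terms are at most
  -- `Θ`.
  · linarith
  · exfalso
    refine hx (Jobs.mem_badEvent hs hp ht hΦ hq hq1 hδ hδ1 hv hδv hΦ₀ (le_trans ?_ hk) h)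
    rw [hΘ]
    gcongr
    linarith

end BadEvent

/-! ### From the bad event to the expected ratio; vanishing processing times. -/

section Expectation

open MeasureTheory ProbabilityTheory

variable {I : Jobs n} {s q δ v : ℝ}

theorem Jobs.le_maxFlow (I : Jobs n) (t : Fin n → ℝ) (j : Fin n) :
    t j + I.p j - I.r j ≤ I.maxFlow t :=
  le_ciSup (f := fun j => t j + I.p j - I.r j) (Set.finite_range _).bddAbove j

theorem Jobs.balanceFlow_div_optFlow_le [NeZero n] {c : ℝ} (hc : 0 < c)
    (h : ∀ t, I.Feasible s t → ∀ t', I.IsBalanceSchedule s t' → ∀ j,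
      t' j + I.p j - I.r j ≤ c * I.maxFlow t) :
    I.balanceFlow s / I.optFlow s ≤ ENNReal.ofReal c := by
  refine ENNReal.div_le_of_le_mul ?_
  have hc0 : ENNReal.ofReal c ≠ 0 := (ENNReal.ofReal_pos.2 hc).ne'
  rw [mul_comm, ← ENNReal.div_le_iff_le_mul (Or.inl hc0) (Or.inl ENNReal.ofReal_ne_top)]
  refine le_iInf₂ fun t ht => ?_
  rw [ENNReal.div_le_iff_le_mul (Or.inl hc0) (Or.inl ENNReal.ofReal_ne_top), mul_comm,
    ← ENNReal.ofReal_mul hc.le]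
  exact iSup₂_le fun t' ht' => ENNReal.ofReal_le_ofReal (ciSup_le fun j => h t ht t' ht' j)

/-- The singularity of `(1 + u)⁻¹ᐟ²` near `-1`. -/
def rootSingularity (η u : ℝ) : ℝ≥0∞ :=
  (Set.Ioo (-1) (-1 + η)).indicator (fun u => ENNReal.ofReal (1 / √(1 + u))) u

theorem measurable_rootSingularity (η : ℝ) : Measurable (rootSingularity η) := by
  refine Measurable.indicator ?_ measurableSet_Ioo
  exact (measurable_const.div (measurable_const.add measurable_id).sqrt).ennreal_ofReal

/-- A single reciprocal `1 / (1 + u)` need not be integrable, but a product of two independent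
inverse square roots is. The cutoff `η` matters: the singular part will have mean of order `η`. -/
theorem ofReal_one_div_max_le {η a b : ℝ} (hη : 0 < η) (ha : -1 < a) (hb : -1 < b) :
    ENNReal.ofReal (1 / max (1 + a) (1 + b)) ≤
      ENNReal.ofReal (1 / η) + rootSingularity η a * rootSingularity η b := by
  have ha' : 0 < 1 + a := by linarith
  have hb' : 0 < 1 + b := by linarith
  rcases le_or_gt η (max (1 + a) (1 + b)) with h | h
  · exact (ENNReal.ofReal_le_ofReal (one_div_le_one_div_of_le hη h)).trans le_self_add
  · refine le_trans ?_ le_add_self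
    obtain ⟨h1, h2⟩ := max_lt_iff.1 h
    rw [rootSingularity, rootSingularity,
      Set.indicator_of_mem (show a ∈ Set.Ioo (-1) (-1 + η) from ⟨ha, by linarith⟩),
      Set.indicator_of_mem (show b ∈ Set.Ioo (-1) (-1 + η) from ⟨hb, by linarith⟩), ← ENNReal.ofReal_mul (by positivity)]
    apply ENNReal.ofReal_le_ofReal
    rw [div_mul_div_comm, one_mul]
    have hsa := Real.sqrt_pos.2 ha'
    have hsb := Real.sqrt_pos.2 hb'
    apply one_div_le_one_div_of_le (by positivity)
    have e1 : √(1 + a) ≤ √(max (1 + a) (1 + b)) := Real.sqrt_le_sqrt (le_max_left _ _)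
    have e2 : √(1 + b) ≤ √(max (1 + a) (1 + b)) := Real.sqrt_le_sqrt (le_max_right _ _)
    calc √(1 + a) * √(1 + b) ≤ √(max (1 + a) (1 + b)) * √(max (1 + a) (1 + b)) := by gcongr
      _ = max (1 + a) (1 + b) := Real.mul_self_sqrt (ha'.le.trans (le_max_left _ _))

theorem lintegral_rootSingularity_mul {μ : Measure ℝ} [IsProbabilityMeasure μ] (η : ℝ)
    {i j : Fin n} (hij : i ≠ j) :
    ∫⁻ x, rootSingularity η (x i) * rootSingularity η (x j) ∂(Measure.pi fun _ : Fin n => μ) =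
      (∫⁻ u, rootSingularity η u ∂μ) ^ 2 := by
  have hm := measurable_rootSingularity η
  have he : ∀ k : Fin n, ∫⁻ x, rootSingularity η (x k) ∂(Measure.pi fun _ : Fin n => μ) =
      ∫⁻ u, rootSingularity η u ∂μ := fun k =>
    (measurePreserving_eval (fun _ : Fin n => μ) k).lintegral_comp hm
  rw [lintegral_mul_of_dependsOn (f := fun x => rootSingularity η (x i))
    (g := fun x => rootSingularity η (x j)) (S := {i}) (T := {j}) (hm.comp (measurable_pi_apply i))
    (hm.comp (measurable_pi_apply j)) (by simpa using hij), he, he, sq]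
  · intro x y hxy; simp only [hxy i (by simp)]
  · intro x y hxy; simp only [hxy j (by simp)]

/-- The optimum is at least every processing time, hence at least `max (1 + x i) (1 + x j)`; this
converts additive constants into multiples of the optimum. -/
theorem Jobs.ratio_le [NeZero n] {x : Fin n → ℝ} (hI : I.Admissible) (hs : 0 ≤ s)
    (hx : ∀ j, -1 < x j) (i j : Fin n) :
    (I.perturb x).balanceFlow s / (I.perturb x).optFlow s ≤
      ENNReal.ofReal (n * (1 + s * (1 / max (1 + x i) (1 + x j)))) ∧
    (0 < q → q ≤ 1 → 0 < δ → δ ≤ 1 / 2 → 0 < v → 128 * (s * (2 + s)) * δ ≤ q * v →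
      x ∉ I.badEvent s q δ v → (I.perturb x).balanceFlow s / (I.perturb x).optFlow s ≤
      ENNReal.ofReal (209 * (16 / (q * δ) *
        (1 + (4 * s + s ^ 2 + 1) * (1 / max (1 + x i) (1 + x j)))))) := by
  have hp1 : ∀ k, 1 + x k ≤ (I.perturb x).p k := fun k =>
    le_mul_of_one_le_right (by linarith [hx k]) (hI.1 k)
  have hp : ∀ k, 0 < (I.perturb x).p k := fun k => by linarith [hp1 k, hx k]
  set M := max (1 + x i) (1 + x j) with hM
  have hM0 : 0 < M := lt_of_lt_of_le (by linarith [hx i]) (le_max_left _ _)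
  have hn : (0 : ℝ) < n := by exact_mod_cast Nat.pos_of_ne_zero (NeZero.ne n)
  have hpt : ∀ t, (I.perturb x).Feasible s t → ∀ k,
      (I.perturb x).p k ≤ (I.perturb x).maxFlow t := fun t ht k => by
    linarith [(I.perturb x).le_maxFlow t k, ht.release k]
  have hMt : ∀ t, (I.perturb x).Feasible s t → 1 ≤ 1 / M * (I.perturb x).maxFlow t := by
    intro t ht
    rw [one_div, inv_mul_eq_div, le_div_iff₀ hM0, one_mul]
    exact max_le ((hp1 i).trans (hpt t ht i)) ((hp1 j).trans (hpt t ht j))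
  refine ⟨Jobs.balanceFlow_div_optFlow_le (by positivity) fun t ht t' ht' k => ?_,
    fun hq hq1 hδ hδ1 hv hδv hB => Jobs.balanceFlow_div_optFlow_le (by positivity)
      fun t ht t' ht' k => ?_⟩
  · obtain ⟨S, hS, hdone, rfl⟩ := ht'
    have h1 := hS.flow_le_card_mul hs (show ∀ k, 0 ≤ (I.perturb x).r k from hI.2) hp (Q := s + (I.perturb x).maxFlow t)
      (fun k => by linarith [hpt t ht k]) k (by rw [hdone]; exact Finset.mem_univ _)
    rw [hdone, Finset.card_univ, Fintype.card_fin] at h1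
    refine h1.trans ?_
    rw [mul_assoc]
    gcongr
    nlinarith [hMt t ht, mul_le_mul_of_nonneg_left (hMt t ht) hs]
  · have h1 := ht'.flow_le hI hs hp ht ((I.perturb x).le_maxFlow t) hq hq1 hδ hδ1 hv hδv
      ((hp k).le.trans (hpt t ht k)) hB k
    refine h1.trans ?_
    rw [mul_assoc 209, mul_assoc (16 / (q * δ))]
    gcongr
    have hA : 0 ≤ 4 * s + s ^ 2 + 1 := by positivity
    nlinarith [mul_le_mul_of_nonneg_left (hMt t ht) hA]

theorem Jobs.lintegral_ratio_le {μ : Measure ℝ} [IsProbabilityMeasure μ] {K G : ℝ}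
    (hI : I.Admissible) (hμ : MomentBounds μ v K) (hμ1 : ∀ᵐ u ∂μ, -1 < u)
    (hK : 3 ≤ K) (hv : 0 < v) (hs : 0 ≤ s) (hG : 0 ≤ G)
    (hμG : ∀ η, 0 < η → η ≤ 1 / 2 →
      ∫⁻ u, rootSingularity η u ∂μ ≤ ENNReal.ofReal (G * √η))
    (hq : q = 1 / (32 * K)) (hδ : 0 < δ) (hδ2 : δ ≤ 1 / 2)
    (hδv : 128 * (s * (2 + s)) * δ ≤ q * v) (hn : 2 ≤ n) (hδn : δ * Real.log n ≤ 4) :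
    ∫⁻ x, (I.perturb x).balanceFlow s / (I.perturb x).optFlow s
        ∂(Measure.pi fun _ : Fin n => μ) ≤
      ENNReal.ofReal (209 * (16 / (q * δ) * (1 + (4 * s + s ^ 2 + 1) * (2 + G ^ 2))) +
        (2 * (1 + s) ^ 3 + s * G ^ 2)) := by
  have : NeZero n := ⟨by omega⟩
  set P := Measure.pi fun _ : Fin n => μ with hP
  have hq0 : 0 < q := by rw [hq]; positivity
  have hq1 : q ≤ 1 := by rw [hq, div_le_one (by linarith)]; linarith
  have hnR : (2 : ℝ) ≤ n := by exact_mod_cast hn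
  have hn0 : (0 : ℝ) < n := by linarith
  let i : Fin n := ⟨0, by omega⟩
  let j : Fin n := ⟨1, by omega⟩
  have hij : i ≠ j := by simp [i, j]
  set A := 4 * s + s ^ 2 + 1 with hA
  have hA0 : 0 ≤ A := by positivity
  set c := 209 * (16 / (q * δ)) with hc
  have hc0 : 0 ≤ c := by positivity
  -- A measurable hull of the same measure avoids any measurability question about the bad event.
  set B := toMeasurable P (I.badEvent s q δ v) with hB
  have hBm : MeasurableSet B := measurableSet_toMeasurable _ _
  let R : ℝ → (Fin n → ℝ) → ℝ≥0∞ := fun η x => rootSingularity η (x i) * rootSingularity η (x j)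
  have hRm : ∀ η, Measurable (R η) := fun η =>
    ((measurable_rootSingularity η).comp (measurable_pi_apply i)).mul
      ((measurable_rootSingularity η).comp (measurable_pi_apply j))
  have hRint : ∀ η, 0 < η → η ≤ 1 / 2 → ∫⁻ x, R η x ∂P ≤ ENNReal.ofReal (G ^ 2 * η) := by
    intro η h0 h1
    change ∫⁻ x, rootSingularity η (x i) * rootSingularity η (x j) ∂P ≤ _
    rw [hP, lintegral_rootSingularity_mul η hij]
    calc _ ≤ ENNReal.ofReal (G * √η) ^ 2 := by gcongr; exact hμG η h0 h1
      _ = ENNReal.ofReal (G ^ 2 * η) := by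
        rw [← ENNReal.ofReal_pow (by positivity), mul_pow, Real.sq_sqrt h0.le]
  have hPB : P B ≤ ENNReal.ofReal ((1 + s) ^ 2 * n ^ 3 * Real.exp (-(20 / δ))) := by
    rw [hB, measure_toMeasurable]
    refine (Jobs.measure_badEvent_le hI hμ hK hv hs hq hδ hδ2).trans ?_
    rw [← ENNReal.ofReal_natCast, ← ENNReal.ofReal_natCast (n := n),
      ← ENNReal.ofReal_mul (by positivity), ← ENNReal.ofReal_mul (by positivity),
      ← ENNReal.ofReal_mul (by positivity)]
    apply ENNReal.ofReal_le_ofReal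
    have h1 : (⌈s * (1 + s) * n⌉₊ : ℝ) ≤ (1 + s) ^ 2 * n := by
      have := (Nat.ceil_lt_add_one (a := s * (1 + s) * n) (by positivity)).le
      nlinarith [mul_nonneg hs hn0.le]
    calc (⌈s * (1 + s) * n⌉₊ : ℝ) * (n * (n * Real.exp (-(20 / δ))))
        ≤ ((1 + s) ^ 2 * n) * (n * (n * Real.exp (-(20 / δ)))) := by gcongr
      _ = _ := by ring
  have hexp : Real.exp (-(20 / δ)) ≤ 1 / n ^ 5 := by
    have h1 : 5 * Real.log n ≤ 20 / δ := by
      rw [le_div_iff₀ hδ]; linarith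
    have h2 : (n : ℝ) ^ 5 = Real.exp (5 * Real.log n) := by
      rw [mul_comm, Real.exp_mul, Real.exp_log hn0]
      norm_cast
    rw [h2, one_div, ← Real.exp_neg]
    exact Real.exp_le_exp.2 (by linarith)
  -- On the bad event the cutoff is `1 / n`, so that the singular term, of mean at most `G ^ 2 / n`,
  -- compensates the factor `n * s`. Elsewhere a constant cutoff is enough.
  have hpt : ∀ᵐ x ∂P, (I.perturb x).balanceFlow s / (I.perturb x).optFlow s ≤
      (ENNReal.ofReal (c * (1 + A * 2)) + ENNReal.ofReal (c * A) * R (1 / 2) x) +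
        (B.indicator (fun _ => ENNReal.ofReal (n * (1 + s * n))) x +
          ENNReal.ofReal (n * s) * R (1 / n) x) := by
    filter_upwards [ae_pi_forall hμ1] with x hx
    obtain ⟨h1, h2⟩ := Jobs.ratio_le (q := q) (δ := δ) (v := v) hI hs hx i j
    have hw0 : 0 ≤ 1 / max (1 + x i) (1 + x j) := by
      have := hx i
      have : 0 < max (1 + x i) (1 + x j) := lt_of_lt_of_le (by linarith) (le_max_left _ _)
      positivity
    set w := 1 / max (1 + x i) (1 + x j) with hw
    have hw' : ∀ η, 0 < η → ENNReal.ofReal w ≤ ENNReal.ofReal (1 / η) + R η x := fun η hη =>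
      ofReal_one_div_max_le hη (hx i) (hx j)
    by_cases hxB : x ∈ B
    · refine le_trans ?_ le_add_self
      rw [Set.indicator_of_mem hxB]
      refine h1.trans ?_
      have e : (n : ℝ) * (1 + s * w) = n + n * s * w := by ring
      rw [e, ENNReal.ofReal_add (by positivity) (by positivity),
        ENNReal.ofReal_mul (p := n * s) (by positivity)]
      calc _ ≤ ENNReal.ofReal n +
            ENNReal.ofReal (n * s) * (ENNReal.ofReal (1 / (1 / n)) + R (1 / n) x) := by
            gcongr; exact hw' _ (by positivity)
        _ = _ := by
            rw [mul_add, ← add_assoc, ← ENNReal.ofReal_mul (by positivity),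
              ← ENNReal.ofReal_add (by positivity) (by positivity)]
            congr 2
            field_simp
    · refine le_trans ?_ le_self_add
      refine (h2 hq0 hq1 hδ hδ2 hv hδv fun h => hxB (subset_toMeasurable _ _ h)).trans ?_
      have e : 209 * (16 / (q * δ) * (1 + A * w)) = c + c * A * w := by rw [hc]; ring
      rw [e, ENNReal.ofReal_add (by positivity) (by positivity),
        ENNReal.ofReal_mul (p := c * A) (by positivity)]
      calc _ ≤ ENNReal.ofReal c +
            ENNReal.ofReal (c * A) * (ENNReal.ofReal (1 / (1 / 2)) + R (1 / 2) x) := by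
            gcongr; exact hw' _ (by norm_num)
        _ = _ := by
            rw [mul_add, ← add_assoc, ← ENNReal.ofReal_mul (by positivity),
              ← ENNReal.ofReal_add (by positivity) (by positivity)]
            congr 2
            ring
  have hFm : Measurable fun x => ENNReal.ofReal (c * (1 + A * 2)) +
      ENNReal.ofReal (c * A) * R (1 / 2) x := measurable_const.add ((hRm _).const_mul _)
  refine (lintegral_mono_ae hpt).trans ?_
  rw [lintegral_add_left hFm,
    lintegral_add_left measurable_const, lintegral_const_mul _ (hRm _),
    lintegral_add_left (measurable_const.indicator hBm), lintegral_const_mul _ (hRm _),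
    lintegral_indicator_const hBm, lintegral_const, measure_univ, mul_one]
  have hinv : 1 / (n : ℝ) ≤ 1 / 2 := one_div_le_one_div_of_le (by norm_num) hnR
  calc _ ≤ (ENNReal.ofReal (c * (1 + A * 2)) +
          ENNReal.ofReal (c * A) * ENNReal.ofReal (G ^ 2 * (1 / 2))) +
        (ENNReal.ofReal (n * (1 + s * n)) *
            ENNReal.ofReal ((1 + s) ^ 2 * n ^ 3 * Real.exp (-(20 / δ))) +
          ENNReal.ofReal (n * s) * ENNReal.ofReal (G ^ 2 * (1 / n))) := by
        gcongr
        · exact hRint _ (by norm_num) le_rfl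
        · exact hRint _ (by positivity) hinv
    _ = ENNReal.ofReal ((c * (1 + A * 2) + c * A * (G ^ 2 * (1 / 2))) +
        (n * (1 + s * n) * ((1 + s) ^ 2 * n ^ 3 * Real.exp (-(20 / δ))) +
          n * s * (G ^ 2 * (1 / n)))) := by
        rw [ENNReal.ofReal_add (by positivity) (by positivity),
          ENNReal.ofReal_add (by positivity) (by positivity),
          ENNReal.ofReal_add (by positivity) (by positivity),
          ENNReal.ofReal_mul (p := c * A) (by positivity),
          ENNReal.ofReal_mul (p := n * (1 + s * n)) (by positivity),
          ENNReal.ofReal_mul (p := n * s) (by positivity)]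
    _ ≤ _ := by
        apply ENNReal.ofReal_le_ofReal
        have h1 : c * (1 + A * 2) + c * A * (G ^ 2 * (1 / 2)) ≤
            209 * (16 / (q * δ) * (1 + A * (2 + G ^ 2))) := by
          have : 0 ≤ c * A * G ^ 2 := by positivity
          have e : 209 * (16 / (q * δ) * (1 + A * (2 + G ^ 2))) =
            c * (1 + A * 2) + c * A * G ^ 2 := by rw [hc]; ring
          rw [e]; linarith
        have h2 : n * (1 + s * n) * ((1 + s) ^ 2 * n ^ 3 * Real.exp (-(20 / δ))) ≤
            2 * (1 + s) ^ 3 := by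
          calc n * (1 + s * n) * ((1 + s) ^ 2 * n ^ 3 * Real.exp (-(20 / δ)))
              ≤ n * ((1 + s) * n) * ((1 + s) ^ 2 * n ^ 3 * (1 / n ^ 5)) := by
                gcongr; nlinarith
            _ = (1 + s) ^ 3 := by field_simp
            _ ≤ 2 * (1 + s) ^ 3 := by
                have : 0 ≤ (1 + s) ^ 3 := by positivity
                linarith
        have h3 : n * s * (G ^ 2 * (1 / n)) = s * G ^ 2 := by field_simp
        linarith

/-- The smoothed competitiveness for laws with variance at least `κ * σ ^ 2` and uniformly bounded
kurtosis, which have little mass near `-1`. -/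
theorem smoothedCompetitiveness_le (s K G κ : ℝ) (hs : 0 ≤ s) (hK : 3 ≤ K) (hG : 0 ≤ G)
    (hκ : 0 < κ) (hκ1 : κ ≤ 1) : ∃ C : ℝ, 0 < C ∧ ∀ (μ : Measure ℝ), IsProbabilityMeasure μ →
      ∀ v σ : ℝ, 0 < σ → σ ≤ 1 → κ * σ ^ 2 ≤ v → MomentBounds μ v K → (∀ᵐ u ∂μ, -1 < u) →
      (∀ η, 0 < η → η ≤ 1 / 2 → ∫⁻ u, rootSingularity η u ∂μ ≤ ENNReal.ofReal (G * √η)) →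
      ∀ n : ℕ, 2 ≤ n → smoothedCompetitiveness n s μ ≤
        ENNReal.ofReal (C * (1 / σ ^ 2) * Real.log n ^ 2) := by
  set q := 1 / (32 * K) with hq
  have hq0 : 0 < q := by positivity
  have hq1 : q ≤ 1 := by rw [hq, div_le_one (by linarith)]; linarith
  set c₀ := q * κ / (4 * (128 * (s * (2 + s)) + 1)) with hc₀
  have hc₀0 : 0 < c₀ := by positivity
  have hc₀1 : c₀ ≤ 1 / 4 := by
    rw [hc₀, div_le_iff₀ (by positivity)]
    have : 0 ≤ s * (2 + s) := by positivity
    nlinarith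
  set C₁ := 209 * (16 / (q * c₀) * (1 + (4 * s + s ^ 2 + 1) * (2 + G ^ 2))) +
    (2 * (1 + s) ^ 3 + s * G ^ 2) with hC₁
  have hC₁0 : 0 < C₁ := by positivity
  refine ⟨4 * C₁, by positivity, ?_⟩
  intro μ hμP v σ hσ hσ1 hv hμ hμ1 hμG n hn
  have hlog : 1 / 2 ≤ Real.log n := by
    have h1 : Real.log 2 ≤ Real.log n := Real.log_le_log (by norm_num) (by exact_mod_cast hn)
    have h2 := Real.log_two_gt_d9
    linarith
  have hlog0 : 0 < Real.log n := by linarith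
  have hσ2 : σ ^ 2 ≤ 1 := pow_le_one₀ hσ.le hσ1
  have hσ20 : 0 < σ ^ 2 := by positivity
  -- As large as possible in order: `δ * log n` bounded makes the bad event of probability `O(n ^
  -- (-2))`, enough against a ratio of order `n ^ 2`, and `c₀` is small enough for `hδv`.
  set δ := c₀ * σ ^ 2 / Real.log n with hδ
  have hδ0 : 0 < δ := by positivity
  have hδc : δ ≤ 2 * (c₀ * σ ^ 2) := by
    rw [hδ, div_le_iff₀ hlog0]
    have : 0 ≤ c₀ * σ ^ 2 := by positivity
    nlinarith
  have hδ2 : δ ≤ 1 / 2 := by nlinarith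
  have hδn : δ * Real.log n ≤ 4 := by
    rw [hδ, div_mul_cancel₀ _ hlog0.ne']
    nlinarith
  have hδv : 128 * (s * (2 + s)) * δ ≤ q * v := by
    have h0 : 0 ≤ s * (2 + s) := by positivity
    calc 128 * (s * (2 + s)) * δ ≤ 128 * (s * (2 + s)) * (2 * (c₀ * σ ^ 2)) := by gcongr
      _ ≤ (4 * (128 * (s * (2 + s)) + 1)) * (c₀ * σ ^ 2) := by
          have : 0 ≤ c₀ * σ ^ 2 := by positivity
          nlinarith
      _ = q * (κ * σ ^ 2) := by rw [hc₀]; field_simp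
      _ ≤ q * v := by gcongr
  refine iSup₂_le fun I hI => ?_
  refine (Jobs.lintegral_ratio_le hI hμ hμ1 hK (lt_of_lt_of_le (by positivity) hv) hs hG hμG hq
    hδ0 hδ2 hδv hn hδn).trans (ENNReal.ofReal_le_ofReal ?_)
  have hL : 1 ≤ Real.log n / σ ^ 2 * 2 := by
    rw [div_mul_eq_mul_div, le_div_iff₀ hσ20]; linarith
  have hL0 : 0 < Real.log n / σ ^ 2 := by positivity
  have e1 : 16 / (q * δ) = 16 / (q * c₀) * (Real.log n / σ ^ 2) := by
    rw [hδ]; field_simp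
  rw [e1]
  set X := 16 / (q * c₀) with hX
  set Y := 1 + (4 * s + s ^ 2 + 1) * (2 + G ^ 2) with hY
  set Z := 2 * (1 + s) ^ 3 + s * G ^ 2 with hZ
  set l := Real.log n / σ ^ 2 with hl
  have hXY : 0 ≤ X * Y := by positivity
  have hZ0 : 0 ≤ Z := by positivity
  -- The argument yields `log n / σ ^ 2`; the second logarithm is given away using `1 ≤ 2 * log n`.
  calc 209 * (X * l * Y) + Z ≤ C₁ * (2 * l) := by
        rw [hC₁]
        nlinarith [mul_le_mul_of_nonneg_left hL hZ0, mul_nonneg hXY hL0.le]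
    _ ≤ C₁ * (2 * (l * (2 * Real.log n))) := by
        gcongr
        exact le_mul_of_one_le_right hL0.le (by linarith)
    _ = 4 * C₁ * (1 / σ ^ 2) * Real.log n ^ 2 := by rw [hl]; ring

end Expectation

/-! ### Moments and density near `-1` for the uniform and the truncated normal law. -/

section Laws

open MeasureTheory ProbabilityTheory

/-- Where the density is at most `c`, this is `c` times the integral of `u ^ (-1 / 2)` over `(0,
η)`. -/
theorem lintegral_rootSingularity_le {μ : Measure ℝ} {c : ℝ} (hc : 0 ≤ c)
    (hμ : μ.restrict (Set.Ioo (-1) (-(1 / 2))) ≤ ENNReal.ofReal c • volume) {η : ℝ} (hη : 0 < η)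
    (hη2 : η ≤ 1 / 2) : ∫⁻ u, rootSingularity η u ∂μ ≤ ENNReal.ofReal (2 * c * √η) := by
  have hsub : Set.Ioo (-1) (-1 + η) ⊆ Set.Ioo (-1 : ℝ) (-(1 / 2)) :=
    Set.Ioo_subset_Ioo_right (by linarith)
  have h1 : ∫⁻ u, rootSingularity η u ∂μ ≤
      ENNReal.ofReal c * ∫⁻ u in Set.Ioo (-1) (-1 + η), ENNReal.ofReal (1 / √(1 + u)) := by
    unfold rootSingularity
    rw [lintegral_indicator measurableSet_Ioo, ← Measure.restrict_restrict_of_subset hsub,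
      ← smul_eq_mul, ← lintegral_smul_measure, ← Measure.restrict_smul]
    exact lintegral_mono' (Measure.restrict_mono le_rfl hμ) le_rfl
  have hii : IntervalIntegrable (fun u : ℝ => (1 + u) ^ (-(1 / 2) : ℝ)) volume (-1) (-1 + η) := by
    have := (intervalIntegral.intervalIntegrable_rpow' (a := 0) (b := η)
      (r := (-(1 / 2) : ℝ)) (by norm_num)).comp_add_left 1
    convert this using 1 <;> ring
  have h2 : ∫⁻ u in Set.Ioo (-1) (-1 + η), ENNReal.ofReal (1 / √(1 + u)) =
      ENNReal.ofReal (2 * √η) := by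
    have e1 : ∫⁻ u in Set.Ioo (-1) (-1 + η), ENNReal.ofReal (1 / √(1 + u)) =
        ∫⁻ u in Set.Ioc (-1) (-1 + η), ENNReal.ofReal ((1 + u) ^ (-(1 / 2) : ℝ)) := by
      rw [Measure.restrict_congr_set Ioo_ae_eq_Ioc]
      refine setLIntegral_congr_fun measurableSet_Ioc fun u hu => ?_
      have hu0 : 0 ≤ 1 + u := by linarith [hu.1]
      rw [Real.rpow_neg hu0, ← Real.sqrt_eq_rpow, one_div]
    rw [e1, ← ofReal_integral_eq_lintegral_ofReal]
    · rw [← intervalIntegral.integral_of_le (by linarith),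
        intervalIntegral.integral_comp_add_left (fun u => u ^ (-(1 / 2) : ℝ)) 1,
        integral_rpow (Or.inl (by norm_num))]
      congr 1
      rw [Real.sqrt_eq_rpow]
      norm_num
      ring
    · exact (intervalIntegrable_iff_integrableOn_Ioc_of_le (by linarith)).1 hii
    · filter_upwards [ae_restrict_mem measurableSet_Ioc] with u hu
      exact Real.rpow_nonneg (by linarith [hu.1]) _
  rw [h2, ← ENNReal.ofReal_mul hc] at h1
  exact h1.trans_eq (by ring_nf)

section Uniform

variable {ε : ℝ}

theorem isProbabilityMeasure_uniformSmoothing (h0 : 0 < ε) :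
    IsProbabilityMeasure (uniformSmoothing ε) := by
  refine cond_isProbabilityMeasure_of_finite ?_ ?_
  · rw [Real.volume_Icc]
    exact (ENNReal.ofReal_pos.2 (by linarith)).ne'
  · rw [Real.volume_Icc]
    exact ENNReal.ofReal_ne_top

theorem integral_pow_uniformSmoothing (h0 : 0 < ε) (k : ℕ) :
    ∫ x, x ^ k ∂(uniformSmoothing ε) =
      (ε ^ (k + 1) - (-ε) ^ (k + 1)) / (k + 1) / (2 * ε) := by
  unfold uniformSmoothing ProbabilityTheory.cond
  rw [integral_smul_measure, integral_Icc_eq_integral_Ioc,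
    ← intervalIntegral.integral_of_le (by linarith), integral_pow, Real.volume_Icc,
    ENNReal.toReal_inv, ENNReal.toReal_ofReal (by linarith), smul_eq_mul, div_eq_inv_mul _ (2 * ε)]
  congr 2
  ring

theorem ae_mem_uniformSmoothing : ∀ᵐ x ∂(uniformSmoothing ε), x ∈ Set.Icc (-ε) ε :=
  ae_cond_mem measurableSet_Icc

theorem momentBounds_uniformSmoothing (h0 : 0 < ε) (h1 : ε < 1) :
    MomentBounds (uniformSmoothing ε) (ε ^ 2 / 3) 3 where
  abs_le := ae_mem_uniformSmoothing.mono fun x hx =>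
    abs_le.2 ⟨by linarith [hx.1], by linarith [hx.2]⟩
  mean := by
    have := integral_pow_uniformSmoothing h0 1
    simp only [pow_one] at this
    rw [this]
    ring
  variance := by
    rw [integral_pow_uniformSmoothing h0 2]
    push_cast
    field_simp
    ring
  fourth := by
    rw [integral_pow_uniformSmoothing h0 4]
    have : (ε ^ (4 + 1) - (-ε) ^ (4 + 1)) / ((4 : ℕ) + 1) / (2 * ε) = ε ^ 4 / 5 := by
      push_cast
      field_simp
      ring
    rw [this]
    have : 0 ≤ ε ^ 4 := by positivity
    nlinarith

theorem uniformSmoothing_restrict_le (ε : ℝ) :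
    (uniformSmoothing ε).restrict (Set.Ioo (-1) (-(1 / 2))) ≤ ENNReal.ofReal 1 • volume := by
  rw [ENNReal.ofReal_one, one_smul]
  -- For small `ε` there is no mass below `-1 / 2`; otherwise the density `1 / (2 * ε)` is at most
  -- `1`.
  rcases le_or_gt ε (1 / 2) with h | h
  · have : (uniformSmoothing ε).restrict (Set.Ioo (-1) (-(1 / 2))) = 0 := by
      rw [Measure.restrict_eq_zero]
      refine measure_mono_null (t := (Set.Icc (-ε) ε)ᶜ) (fun x hx hx' => ?_)
        (mem_ae_iff.1 ae_mem_uniformSmoothing)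
      linarith [hx.2, hx'.1]
    rw [this]
    exact Measure.zero_le _
  · refine Measure.restrict_le_self.trans ?_
    unfold uniformSmoothing ProbabilityTheory.cond
    rw [Real.volume_Icc]
    have h1 : (ENNReal.ofReal (ε - -ε))⁻¹ ≤ 1 := by
      rw [ENNReal.inv_le_one, ENNReal.one_le_ofReal]
      linarith
    calc (ENNReal.ofReal (ε - -ε))⁻¹ • volume.restrict (Set.Icc (-ε) ε)
        ≤ (1 : ℝ≥0∞) • volume.restrict (Set.Icc (-ε) ε) := by gcongr
      _ ≤ volume := by rw [one_smul]; exact Measure.restrict_le_self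

end Uniform

section Normal

variable {σ : ℝ}

theorem toNNReal_sq_ne_zero (h0 : 0 < σ) : (σ ^ 2).toNNReal ≠ 0 :=
  (Real.toNNReal_pos.2 (by positivity)).ne'

theorem gaussianPDFReal_toNNReal_sq (h0 : 0 < σ) (x : ℝ) :
    gaussianPDFReal 0 (σ ^ 2).toNNReal x =
      (σ * √(2 * Real.pi))⁻¹ * Real.exp (-(x ^ 2 / (2 * σ ^ 2))) := by
  rw [gaussianPDFReal, Real.coe_toNNReal _ (sq_nonneg σ), sub_zero, mul_comm (2 * Real.pi),
    Real.sqrt_mul (sq_nonneg σ), Real.sqrt_sq h0.le, neg_div]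

/-- Uniform in `σ`: for small `σ` the exponential beats the factor `1 / σ`, already through `1 + y ≤
exp y` and the lower bound on `σ + 1 / (8 * σ)`. -/
theorem gaussianPDFReal_le_one (h0 : 0 < σ) {x : ℝ} (hx : x < -(1 / 2)) :
    gaussianPDFReal 0 (σ ^ 2).toNNReal x ≤ 1 := by
  rw [gaussianPDFReal_toNNReal_sq h0, Real.exp_neg, ← mul_inv]
  apply inv_le_one_of_one_le₀
  have hx2 : 1 / 4 ≤ x ^ 2 := by nlinarith
  have h1 : 1 + 1 / (8 * σ ^ 2) ≤ Real.exp (x ^ 2 / (2 * σ ^ 2)) := by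
    have h2 : 1 / (8 * σ ^ 2) ≤ x ^ 2 / (2 * σ ^ 2) := by
      rw [div_le_div_iff₀ (by positivity) (by positivity)]
      nlinarith [sq_pos_of_pos h0]
    linarith [Real.add_one_le_exp (x ^ 2 / (2 * σ ^ 2))]
  have h3 : 2 ≤ √(2 * Real.pi) := by
    apply Real.le_sqrt_of_sq_le
    nlinarith [Real.pi_gt_three]
  have h4 : 1 / 2 ≤ σ * (1 + 1 / (8 * σ ^ 2)) := by
    have : σ * (1 + 1 / (8 * σ ^ 2)) = σ + 1 / (8 * σ) := by field_simp
    rw [this]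
    have : 1 / (8 * σ) * σ = 1 / 8 := by field_simp
    have h5 : 0 < 1 / (8 * σ) := by positivity
    nlinarith [sq_nonneg (σ - 1 / (8 * σ))]
  calc 1 = 2 * (1 / 2) := by norm_num
    _ ≤ √(2 * Real.pi) * (σ * (1 + 1 / (8 * σ ^ 2))) := by gcongr
    _ ≤ √(2 * Real.pi) * (σ * Real.exp (x ^ 2 / (2 * σ ^ 2))) := by gcongr
    _ = σ * √(2 * Real.pi) * Real.exp (x ^ 2 / (2 * σ ^ 2)) := by ring

theorem le_gaussianPDFReal (h0 : 0 < σ) {x : ℝ} (hx0 : 0 ≤ x) (hx : x ≤ σ) :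
    1 / (6 * σ) ≤ gaussianPDFReal 0 (σ ^ 2).toNNReal x := by
  rw [gaussianPDFReal_toNNReal_sq h0]
  have h1 : 1 / 2 ≤ Real.exp (-(x ^ 2 / (2 * σ ^ 2))) := by
    have h2 : x ^ 2 / (2 * σ ^ 2) ≤ 1 / 2 := by
      rw [div_le_div_iff₀ (by positivity) (by norm_num)]
      nlinarith
    linarith [Real.add_one_le_exp (-(x ^ 2 / (2 * σ ^ 2)))]
  have h3 : √(2 * Real.pi) ≤ 3 := by
    rw [Real.sqrt_le_left (by norm_num)]
    nlinarith [Real.pi_lt_four]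
  have h4 : 0 < √(2 * Real.pi) := Real.sqrt_pos.2 (by positivity)
  calc 1 / (6 * σ) = (σ * 3)⁻¹ * (1 / 2) := by field_simp; norm_num
    _ ≤ (σ * √(2 * Real.pi))⁻¹ * Real.exp (-(x ^ 2 / (2 * σ ^ 2))) := by gcongr

/-- Serves twice: it bounds the normalising constant of the truncation, and, `x` being at least `σ /
2` there, the variance. -/
theorem le_gaussianReal_real (h0 : 0 < σ) :
    1 / 12 ≤ (gaussianReal 0 (σ ^ 2).toNNReal).real (Set.Ioo (σ / 2) σ) := by
  rw [measureReal_def, gaussianReal_apply _ (toNNReal_sq_ne_zero h0)]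
  have h1 : ENNReal.ofReal (1 / 12) ≤
      ∫⁻ x in Set.Ioo (σ / 2) σ, gaussianPDF 0 (σ ^ 2).toNNReal x := by
    calc ENNReal.ofReal (1 / 12) =
          ∫⁻ x in Set.Ioo (σ / 2) σ, ENNReal.ofReal (1 / (6 * σ)) := by
          rw [setLIntegral_const, Real.volume_Ioo, ← ENNReal.ofReal_mul (by positivity)]
          congr 1
          field_simp
          norm_num
      _ ≤ _ := setLIntegral_mono (measurable_gaussianPDF _ _) fun x hx =>
          ENNReal.ofReal_le_ofReal (le_gaussianPDFReal h0 (by linarith [hx.1]) hx.2.le)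
  refine (ENNReal.ofReal_le_iff_le_toReal ?_).1 h1
  rw [← gaussianReal_apply _ (toNNReal_sq_ne_zero h0)]
  exact measure_ne_top _ _

theorem le_gaussianReal_Ioo (h0 : 0 < σ) (h1 : σ ≤ 1) :
    1 / 12 ≤ (gaussianReal 0 (σ ^ 2).toNNReal).real (Set.Ioo (-1) 1) :=
  (le_gaussianReal_real h0).trans
    (measureReal_mono (Set.Ioo_subset_Ioo (by linarith) h1))

theorem isProbabilityMeasure_normalSmoothing (h0 : 0 < σ) (h1 : σ ≤ 1) :
    IsProbabilityMeasure (normalSmoothing σ) := by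
  refine cond_isProbabilityMeasure fun h => ?_
  have := le_gaussianReal_Ioo h0 h1
  rw [measureReal_def, h] at this
  norm_num at this

theorem integral_normalSmoothing (f : ℝ → ℝ) :
    ∫ x, f x ∂(normalSmoothing σ) =
      ((gaussianReal 0 (σ ^ 2).toNNReal).real (Set.Ioo (-1) 1))⁻¹ *
        ∫ x in Set.Ioo (-1) 1, f x ∂(gaussianReal 0 (σ ^ 2).toNNReal) := by
  unfold normalSmoothing ProbabilityTheory.cond
  rw [integral_smul_measure, ENNReal.toReal_inv, smul_eq_mul, measureReal_def]

theorem integral_Ioo_gaussianReal_id (v : NNReal) :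
    ∫ x in Set.Ioo (-1) 1, x ∂(gaussianReal 0 v) = 0 := by
  have hm : Measurable ((Set.Ioo (-1 : ℝ) 1).indicator fun x => x) :=
    measurable_id.indicator measurableSet_Ioo
  rw [← integral_indicator measurableSet_Ioo]
  have h1 : ∫ x, (Set.Ioo (-1 : ℝ) 1).indicator (fun x => x) x ∂(gaussianReal 0 v) =
      ∫ x, (Set.Ioo (-1 : ℝ) 1).indicator (fun x => x) (-x) ∂(gaussianReal 0 v) := by
    have := gaussianReal_map_neg (μ := 0) (v := v)
    rw [neg_zero] at this
    conv_lhs => rw [← this]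
    exact integral_map measurable_neg.aemeasurable hm.aestronglyMeasurable
  have h2 : ∀ x : ℝ, (Set.Ioo (-1 : ℝ) 1).indicator (fun x => x) (-x) =
      -(Set.Ioo (-1 : ℝ) 1).indicator (fun x => x) x := by
    intro x
    by_cases hx : x ∈ Set.Ioo (-1 : ℝ) 1
    · have hx' : -x ∈ Set.Ioo (-1 : ℝ) 1 := ⟨by linarith [hx.2], by linarith [hx.1]⟩
      rw [Set.indicator_of_mem hx, Set.indicator_of_mem hx']
    · have hx' : -x ∉ Set.Ioo (-1 : ℝ) 1 :=
        fun h => hx ⟨by linarith [h.2], by linarith [h.1]⟩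
      rw [Set.indicator_of_notMem hx, Set.indicator_of_notMem hx', neg_zero]
  simp_rw [h2] at h1
  rw [integral_neg] at h1
  linarith

theorem integrableOn_pow_gaussianReal (v : NNReal) (k : ℕ) :
    IntegrableOn (fun x => x ^ k) (Set.Ioo (-1) 1) (gaussianReal 0 v) := by
  refine Integrable.of_bound (by fun_prop) 1 ?_
  filter_upwards [ae_restrict_mem measurableSet_Ioo] with x hx
  rw [Real.norm_eq_abs, abs_pow]
  exact pow_le_one₀ (abs_nonneg _) (abs_le.2 ⟨hx.1.le, hx.2.le⟩)

/-- The fourth moment is read off the moment generating function at `±1 / σ`, using `y ^ 4 / 24 ≤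
exp |y|`. -/
theorem integral_Ioo_gaussianReal_pow_four_le (h0 : 0 < σ) :
    ∫ x in Set.Ioo (-1) 1, x ^ 4 ∂(gaussianReal 0 (σ ^ 2).toNNReal) ≤ 96 * σ ^ 4 := by
  set ν := gaussianReal 0 (σ ^ 2).toNNReal
  have hi : ∀ t : ℝ, Integrable (fun x => Real.exp (t * x)) ν := fun t =>
    integrable_exp_mul_gaussianReal t
  have hv : ∀ t : ℝ, ∫ x, Real.exp (t * x) ∂ν = Real.exp (σ ^ 2 * t ^ 2 / 2) := by
    intro t
    have := congrFun (mgf_fun_id_gaussianReal (μ := 0) (v := (σ ^ 2).toNNReal)) t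
    rw [mgf, Real.coe_toNNReal _ (sq_nonneg σ)] at this
    rw [this]
    simp
  have hpt : ∀ x : ℝ, x ^ 4 ≤ 24 * σ ^ 4 * (Real.exp (1 / σ * x) + Real.exp (-(1 / σ) * x)) := by
    intro x
    have h1 := Real.pow_div_factorial_le_exp |x / σ| (abs_nonneg _) 4
    have h2 : Real.exp |x / σ| ≤ Real.exp (1 / σ * x) + Real.exp (-(1 / σ) * x) := by
      have e1 : 1 / σ * x = x / σ := by ring
      have e2 : -(1 / σ) * x = -(x / σ) := by ring
      rw [e1, e2]
      rcases abs_cases (x / σ) with h | h <;> rw [h.1]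
      · linarith [Real.exp_pos (-(x / σ))]
      · linarith [Real.exp_pos (x / σ)]
    have h3 : |x / σ| ^ 4 = x ^ 4 / σ ^ 4 := by
      rw [← abs_pow, abs_of_nonneg (by positivity), div_pow]
    rw [h3] at h1
    have h4 : x ^ 4 / σ ^ 4 / 24 ≤ Real.exp (1 / σ * x) + Real.exp (-(1 / σ) * x) := by
      refine le_trans (le_of_eq ?_) (h1.trans h2)
      norm_num [Nat.factorial]
    rw [div_div, div_le_iff₀ (by positivity)] at h4
    linarith
  have hint := ((hi (1 / σ)).fun_add (hi (-(1 / σ)))).const_mul (24 * σ ^ 4)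
  calc ∫ x in Set.Ioo (-1) 1, x ^ 4 ∂ν
      ≤ ∫ x in Set.Ioo (-1) 1,
          24 * σ ^ 4 * (Real.exp (1 / σ * x) + Real.exp (-(1 / σ) * x)) ∂ν :=
        integral_mono (integrableOn_pow_gaussianReal _ 4) hint.integrableOn hpt
    _ ≤ ∫ x, 24 * σ ^ 4 * (Real.exp (1 / σ * x) + Real.exp (-(1 / σ) * x)) ∂ν :=
        setIntegral_le_integral hint (Filter.Eventually.of_forall fun x => by positivity)
    _ = 24 * σ ^ 4 * (2 * Real.exp (1 / 2)) := by
        rw [integral_const_mul, integral_add (hi _) (hi _), hv, hv]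
        have e1 : σ ^ 2 * (1 / σ) ^ 2 / 2 = 1 / 2 := by field_simp
        have e2 : σ ^ 2 * (-(1 / σ)) ^ 2 / 2 = 1 / 2 := by rw [neg_sq, e1]
        rw [e1, e2]
        ring
    _ ≤ 96 * σ ^ 4 := by
        have h1 : Real.exp (1 / 2) ≤ 2 := by
          have h2 : Real.exp (1 / 2) ^ 2 ≤ 2 ^ 2 := by
            rw [← Real.exp_nat_mul]
            have := Real.exp_one_lt_d9
            norm_num
            linarith
          exact le_of_sq_le_sq h2 (by norm_num)
        have : 0 ≤ σ ^ 4 := by positivity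
        nlinarith

theorem le_variance_normalSmoothing (h0 : 0 < σ) (h1 : σ ≤ 1) :
    1 / 48 * σ ^ 2 ≤ ∫ x, x ^ 2 ∂(normalSmoothing σ) := by
  rw [integral_normalSmoothing]
  set ν := gaussianReal 0 (σ ^ 2).toNNReal with hν
  have hZ := le_gaussianReal_Ioo h0 h1
  have hZ1 : 1 ≤ (ν.real (Set.Ioo (-1) 1))⁻¹ :=
    (one_le_inv₀ (by linarith)).2 measureReal_le_one
  have h2 : (σ / 2) ^ 2 * (1 / 12) ≤ ∫ x in Set.Ioo (-1) 1, x ^ 2 ∂ν := by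
    calc (σ / 2) ^ 2 * (1 / 12) ≤ (σ / 2) ^ 2 * ν.real (Set.Ioo (σ / 2) σ) := by
          gcongr; exact le_gaussianReal_real h0
      _ = ∫ x in Set.Ioo (σ / 2) σ, (σ / 2) ^ 2 ∂ν := by
          rw [setIntegral_const, smul_eq_mul, mul_comm]
      _ ≤ ∫ x in Set.Ioo (σ / 2) σ, x ^ 2 ∂ν := by
          refine setIntegral_mono_on (integrable_const _)
            ((integrableOn_pow_gaussianReal _ 2).mono_set
              (Set.Ioo_subset_Ioo (by linarith) h1)) measurableSet_Ioo fun x hx => ?_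
          exact pow_le_pow_left₀ (by positivity) hx.1.le 2
      _ ≤ ∫ x in Set.Ioo (-1) 1, x ^ 2 ∂ν :=
          setIntegral_mono_set (integrableOn_pow_gaussianReal _ 2)
            (Filter.Eventually.of_forall fun x => sq_nonneg x)
            (Set.Ioo_subset_Ioo (by linarith) h1).eventuallyLE
  have h3 : 0 ≤ ∫ x in Set.Ioo (-1) 1, x ^ 2 ∂ν := integral_nonneg fun x => sq_nonneg x
  nlinarith

/-- Truncation alters the variance, so it is kept as an integral, at least `σ ^ 2 / 48`. The
kurtosis constant combines the normalisation `12`, the fourth moment `96` and `48 ^ 2`. -/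
theorem momentBounds_normalSmoothing (h0 : 0 < σ) (h1 : σ ≤ 1) :
    MomentBounds (normalSmoothing σ) (∫ x, x ^ 2 ∂(normalSmoothing σ)) (12 * 96 * 48 ^ 2) where
  abs_le := (ae_cond_mem measurableSet_Ioo).mono fun x hx => abs_le.2 ⟨hx.1.le, hx.2.le⟩
  mean := by
    rw [integral_normalSmoothing, integral_Ioo_gaussianReal_id, mul_zero]
  variance := rfl
  fourth := by
    have h2 := le_variance_normalSmoothing h0 h1
    have h3 := pow_le_pow_left₀ (by positivity) h2 2
    rw [integral_normalSmoothing (fun x => x ^ 4)]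
    have hZ : ((gaussianReal 0 (σ ^ 2).toNNReal).real (Set.Ioo (-1) 1))⁻¹ ≤ 12 := by
      rw [inv_le_comm₀ (by linarith [le_gaussianReal_Ioo h0 h1]) (by norm_num)]
      linarith [le_gaussianReal_Ioo h0 h1]
    have h4 := integral_Ioo_gaussianReal_pow_four_le h0
    calc _ ≤ 12 * (96 * σ ^ 4) := by
          refine mul_le_mul hZ h4 (integral_nonneg fun x => by positivity) (by norm_num)
      _ = 12 * 96 * 48 ^ 2 * (1 / 48 * σ ^ 2) ^ 2 := by ring
      _ ≤ _ := by gcongr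

theorem normalSmoothing_restrict_le (h0 : 0 < σ) (h1 : σ ≤ 1) :
    (normalSmoothing σ).restrict (Set.Ioo (-1) (-(1 / 2))) ≤ ENNReal.ofReal 12 • volume := by
  unfold normalSmoothing ProbabilityTheory.cond
  set ν := gaussianReal 0 (σ ^ 2).toNNReal with hν
  have hZ : (ν (Set.Ioo (-1) 1))⁻¹ ≤ ENNReal.ofReal 12 := by
    rw [ENNReal.inv_le_iff_inv_le, ← ENNReal.ofReal_inv_of_pos (by norm_num)]
    refine ENNReal.ofReal_le_of_le_toReal ?_
    have := le_gaussianReal_Ioo h0 h1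
    rw [measureReal_def] at this
    linarith
  have hν1 : (ν.restrict (Set.Ioo (-1) 1)).restrict (Set.Ioo (-1) (-(1 / 2))) ≤ volume := by
    rw [Measure.restrict_restrict_of_subset (Set.Ioo_subset_Ioo_right (by norm_num)), hν,
      gaussianReal_of_var_ne_zero _ (toNNReal_sq_ne_zero h0),
      restrict_withDensity measurableSet_Ioo]
    calc _ ≤ (volume.restrict (Set.Ioo (-1 : ℝ) (-(1 / 2)))).withDensity 1 := by
          refine withDensity_mono ?_
          filter_upwards [ae_restrict_mem measurableSet_Ioo] with x hx
          exact ENNReal.ofReal_le_one.2 (gaussianPDFReal_le_one h0 hx.2)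
      _ ≤ volume := by
          rw [withDensity_one]
          exact Measure.restrict_le_self
  rw [Measure.restrict_smul]
  calc _ ≤ (ν (Set.Ioo (-1) 1))⁻¹ • (volume : Measure ℝ) := by gcongr
    _ ≤ _ := by gcongr

end Normal

end Laws

end SetupScheduling

end

theorem mainTheorem4 (s : ℝ) (hs : 0 ≤ s) :
    ∃ C : ℝ, 0 < C ∧ ∀ ε : ℝ, 0 < ε → ε < 1 → ∀ n : ℕ, 2 ≤ n →
      (∀ σ : ℝ, σ = ε / Real.sqrt 3 →
        SetupScheduling.smoothedCompetitiveness n s (SetupScheduling.uniformSmoothing ε) ≤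
          ENNReal.ofReal (C * (1 / σ ^ 2) * Real.log n ^ 2)) ∧
      (∀ σ : ℝ, σ = ε / Real.sqrt 2.64 →
        SetupScheduling.smoothedCompetitiveness n s (SetupScheduling.normalSmoothing σ) ≤
          ENNReal.ofReal (C * (1 / σ ^ 2) * Real.log n ^ 2)) := by
  obtain ⟨C₁, hC₁, h₁⟩ := SetupScheduling.smoothedCompetitiveness_le s 3 (2 * 1) 1 hs le_rfl (by norm_num)
    one_pos le_rfl
  obtain ⟨C₂, hC₂, h₂⟩ := SetupScheduling.smoothedCompetitiveness_le s (12 * 96 * 48 ^ 2) (2 * 12)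
    (1 / 48) hs (by norm_num) (by norm_num) (by norm_num) (by norm_num)
  refine ⟨max C₁ C₂, lt_max_of_lt_left hC₁, fun ε h0 h1 n hn => ⟨?_, ?_⟩⟩
  · rintro σ rfl
    have hσ0 : 0 < ε / √3 := by positivity
    have hσ1 : ε / √3 ≤ 1 := by
      rw [div_le_one (by positivity)]
      exact h1.le.trans (Real.one_le_sqrt.2 (by norm_num))
    refine (h₁ _ (SetupScheduling.isProbabilityMeasure_uniformSmoothing h0) (ε ^ 2 / 3) (ε / √3)
      hσ0 hσ1 ?_ (SetupScheduling.momentBounds_uniformSmoothing h0 h1)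
      (SetupScheduling.ae_mem_uniformSmoothing.mono fun x hx => by linarith [hx.1])
      (fun η => SetupScheduling.lintegral_rootSingularity_le zero_le_one
        (SetupScheduling.uniformSmoothing_restrict_le ε)) n hn).trans
      (ENNReal.ofReal_le_ofReal ?_)
    · rw [div_pow, Real.sq_sqrt (by norm_num), one_mul]
    · gcongr
      exact le_max_left _ _
  · rintro σ rfl
    have hσ0 : 0 < ε / √2.64 := by positivity
    have hσ1 : ε / √2.64 ≤ 1 := by
      rw [div_le_one (by positivity)]
      exact h1.le.trans (Real.one_le_sqrt.2 (by norm_num))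
    refine (h₂ _ (SetupScheduling.isProbabilityMeasure_normalSmoothing hσ0 hσ1) _ (ε / √2.64)
      hσ0 hσ1 (SetupScheduling.le_variance_normalSmoothing hσ0 hσ1)
      (SetupScheduling.momentBounds_normalSmoothing hσ0 hσ1)
      ((ProbabilityTheory.ae_cond_mem measurableSet_Ioo).mono fun x hx => hx.1)
      (fun η => SetupScheduling.lintegral_rootSingularity_le (by norm_num)
        (SetupScheduling.normalSmoothing_restrict_le hσ0 hσ1)) n hn).trans
      (ENNReal.ofReal_le_ofReal ?_)
    gcongr
    exact le_max_right _ _
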